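/- Let $Z=(Z_t,\mathcal F(I),P_{r,z})$ be a time-inhomogeneous right process with a metrizable Luzin state space $S$. That is, $Z$ is a Markov process with time set $[0,\infty)$ and càdlàg paths; $\mathcal F(I)$ is the $\sigma$-algebra of events observable during the interval $I$; $P_{r,z}$ is the law on $\mathcal F[r,\infty)$ under which $Z_r=z$, and $P_{r,\mu}=\int P_{r,z}\,\mu(dz)$; and for all $r<t$, all measurable $f:S\to[0,\infty)$ and all probability measures $\mu$ on $S$, the process $s\mapsto E_{s,Z_s}[f(Z_t)]$ is $P_{r,\mu}$-a.s. right-continuous on $[r,t)$. A nonnegative additive functional of $Z$ is a family of measures $A(\omega,dt)$ on $[0,\infty)$ such that $A[s,t]$ is measurable with respect to $\mathcal F[s,t]$, completed by the $P_{r,\mu}$-null sets ($r\le s$, $\mu$ arbitrary). It is continuous if, $P_{r,z}$-a.s. for all $(r,z)$, it is finite on bounded subintervals of $[r,\infty)$ and has no atoms there. Let $\mathcal A_{(1)}$ be the class of functionals $A[s,u]=\sum_{s\le t_i\le u}f_i(Z_{t_i})$ with finitely many times $t_i$ and bounded measurable $f_i\ge 0$. Let $\mathcal A_{(2)}$ be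 the class of nonnegative additive functionals $A$ for which there are $A_n\in\mathcal A_{(1)}$ with $A_n[r,\infty)\to A[r,\infty)$ $P_{r,z}$-a.s. for all $(r,z)$, and with $A_n[T_0,\infty)=0$ for all $n$ and $\sup_{\omega,n}A_n[0,T_0](\omega)<\infty$ for some $T_0>0$. Let $\mathcal A$ be the class of those $A$ for which there are $A_n\in\mathcal A_{(2)}$ with $A_n(B)\nearrow A(B)$ for all Borel sets $B\subset[0,\infty)$. For $T>0$ let $\mathcal A^1_T$ be the class of $A\in\mathcal A$ such that $E_{r,z}[A[r,T]]<\infty$ and $A(T,\infty)=0$ $P_{r,z}$-a.s. for all $(r,z)\in[0,T]\times S$. **Proposition.** Let $T>0$, let $A,\widetilde A\in\mathcal A^1_T$, and let $L,\widetilde L$ be nonnegative continuous additive functionals of $Z$. Suppose that for all $0\le r\le t\le T$ and $z\in S$ one has $P_{r,z}$-a.s. $A[r,t]\le\widetilde A[r,t]$ and $L[r,t]\ge\widetilde L[r,t]$. Let $q\ge1$ and let $v,\widetilde v:[0,T]\times S\to[0,\infty)$ be finite nonnegative solutions of $$v(r,z)=E_{r,z}\Big[A[r,T]-\int_r^T v(t,Z_t)^q\,L(dt)\Big],\qquad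 \widetilde v(r,z)=E_{r,z}\Big[\widetilde A[r,T]-\int_r^T\widetilde v(t,Z_t)^q\,\widetilde L(dt)\Big]$$ for all $(r,z)\in[0,T]\times S$. Here a solution is understood to be such that $v(t,Z_t)$ is progressively measurable (up to $P_{r,\mu}$-null sets) and $E_{r,z}\big[\int_r^T v(t,Z_t)^q\,L(dt)\big]<\infty$ for all $(r,z)$, and likewise for $\widetilde v$ and $\widetilde L$. Then $v\le\widetilde v$ on $[0,T]\times S$. -/

import Mathlib

open MeasureTheory ProbabilityTheory Set Filter Topology
open scoped NNReal ENNReal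

/-- A time-inhomogeneous Markov process `(X_t, F(I), P_{r,z})` with time set `[0,∞)`, state space
`S` and sample space `Ω`.  The σ-algebra `F I` contains the events observable during the time
interval `I` (its values at sets that are not intervals play no role).  The measure `P r z`, under
which the process starts at time `r` from the point `z`, lives on the σ-algebra `F [r,∞)` and
depends measurably on `z`. -/
structure MarkovProcess (S : Type*) (Ω : Type*) [MeasurableSpace S] where
  X : ℝ≥0 → Ω → S
  F : Set ℝ≥0 → MeasurableSpace Ω
  F_mono : ∀ I J : Set ℝ≥0, I ⊆ J → F I ≤ F J
  X_measurable : ∀ t : ℝ≥0, Measurable[F {t}] (X t)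
  P : (r : ℝ≥0) → @Kernel S Ω _ (F (Ici r))
  P_univ : ∀ (r : ℝ≥0) (z : S), P r z univ = 1
  start : ∀ (r : ℝ≥0) (z : S), ∀ᵐ ω ∂(P r z), X r ω = z
  markov : ∀ (r t : ℝ≥0), r ≤ t → ∀ (z : S) (B C : Set Ω),
    MeasurableSet[F (Icc r t)] B → MeasurableSet[F (Ici t)] C →
      P r z (B ∩ C) = ∫⁻ ω in B, P t (X t ω) C ∂(P r z)

/-- The measure `P_{r,μ} = ∫ P_{r,z} μ(dz)` on `F [r,∞)`. -/
noncomputable def MarkovProcess.law {S Ω : Type*} [MeasurableSpace S] (Z : MarkovProcess S Ω)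
    (r : ℝ≥0) (μ : Measure S) : @Measure Ω (Z.F (Ici r)) :=
  @Measure.bind S Ω _ (Z.F (Ici r)) μ (Z.P r)

/-- A right process: all paths are càdlàg, and for `r < t`, measurable `f : S → [0,∞)` and every
initial distribution `μ`, the `[0,∞]`-valued process `s ↦ E_{s,X_s}[f(X_t)]` is `P_{r,μ}`-almost
surely right-continuous on `[r,t)`. -/
structure RightProcess (S : Type*) (Ω : Type*) [TopologicalSpace S] [MeasurableSpace S]
    extends MarkovProcess S Ω where
  right_continuous : ∀ (ω : Ω) (t : ℝ≥0), ContinuousWithinAt (fun s => X s ω) (Ici t) t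
  left_limits : ∀ (ω : Ω) (t : ℝ≥0), 0 < t → ∃ l : S, Tendsto (fun s => X s ω) (𝓝[<] t) (𝓝 l)
  right : ∀ (r t : ℝ≥0), r < t → ∀ f : S → ℝ≥0, Measurable f →
    ∀ μ : Measure S, IsProbabilityMeasure μ →
      ∀ᵐ ω ∂(toMarkovProcess.law r μ), ∀ s ∈ Ico r t,
        ContinuousWithinAt (fun s' : ℝ≥0 => ∫⁻ ω', (f (X t ω') : ℝ≥0∞) ∂(P s' (X s' ω)))
          (Ici s) s

section

variable {S Ω : Type*} [TopologicalSpace S] [MeasurableSpace S]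

/-- A nonnegative additive functional of `Z`: a random measure `A(ω, dt)` on `[0,∞)` such that
`A[s,t]` is measurable with respect to the universal completion of `F [s,t]`, that is, for every
`r ≤ s` and every `μ` it coincides `P_{r,μ}`-a.s. with an `F [s,t]`-measurable function.  (The
corresponding property for the other intervals follows by monotone limits.) -/
structure AdditiveFunctional (Z : RightProcess S Ω) where
  meas : Ω → Measure ℝ≥0
  adapted : ∀ r s t : ℝ≥0, r ≤ s → s ≤ t → ∀ μ : Measure S, IsProbabilityMeasure μ →
    ∃ g : Ω → ℝ≥0∞, Measurable[Z.F (Icc s t)] g ∧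
      ∀ᵐ ω ∂(Z.law r μ), meas ω (Icc s t) = g ω

namespace AdditiveFunctional

variable {Z : RightProcess S Ω}

/-- `A` is continuous: almost surely it is finite on bounded intervals and has no atoms. -/
def IsContinuous (A : AdditiveFunctional Z) : Prop :=
  ∀ (r : ℝ≥0) (z : S), ∀ᵐ ω ∂(Z.P r z), ∀ t : ℝ≥0, r ≤ t →
    A.meas ω (Icc r t) < ∞ ∧ A.meas ω {t} = 0

/-- The class `𝒜₍₁₎`: `A[s,u] = ∑_{s ≤ tᵢ ≤ u} fᵢ(Z_{tᵢ})` for a finite set of times `tᵢ` and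
bounded measurable functions `fᵢ ≥ 0`, that is, `A(ω, ·) = ∑ᵢ fᵢ(Z_{tᵢ}(ω)) δ_{tᵢ}`. -/
def MemClass1 (A : AdditiveFunctional Z) : Prop :=
  ∃ (τ : Finset ℝ≥0) (f : ℝ≥0 → S → ℝ≥0),
    (∀ t ∈ τ, Measurable (f t)) ∧ (∀ t ∈ τ, ∃ c : ℝ≥0, ∀ z, f t z ≤ c) ∧
      ∀ ω, A.meas ω = ∑ t ∈ τ, (f t (Z.X t ω) : ℝ≥0∞) • Measure.dirac t

/-- The class `𝒜₍₂₎` of limits of uniformly bounded sequences in `𝒜₍₁₎` that live on a common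
bounded time interval. -/
def MemClass2 (A : AdditiveFunctional Z) : Prop :=
  ∃ a : ℕ → AdditiveFunctional Z,
    (∀ n, (a n).MemClass1) ∧
    (∀ (r : ℝ≥0) (z : S), ∀ᵐ ω ∂(Z.P r z),
      Tendsto (fun n => (a n).meas ω (Ici r)) atTop (𝓝 (A.meas ω (Ici r)))) ∧
    ∃ T : ℝ≥0, 0 < T ∧ (∀ n ω, (a n).meas ω (Ici T) = 0) ∧
      ∃ c : ℝ≥0, ∀ n ω, (a n).meas ω (Icc 0 T) ≤ c

/-- The class `𝒜` of increasing limits of sequences in `𝒜₍₂₎`. -/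
def MemClass (A : AdditiveFunctional Z) : Prop :=
  ∃ a : ℕ → AdditiveFunctional Z,
    (∀ n, (a n).MemClass2) ∧
    ∀ (ω : Ω) (B : Set ℝ≥0), MeasurableSet B →
      Monotone (fun n => (a n).meas ω B) ∧
        Tendsto (fun n => (a n).meas ω B) atTop (𝓝 (A.meas ω B))

/-- The class `𝒜_T^q`: members `A` of `𝒜` with `E_{r,z}[A[r,T]^q] < ∞` and `A(T,∞) = 0`
`P_{r,z}`-a.s. for all `(r,z) ∈ [0,T] × S`. -/
def MemClassT (A : AdditiveFunctional Z) (T : ℝ≥0) (q : ℝ) : Prop :=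
  A.MemClass ∧ ∀ r : ℝ≥0, r ≤ T → ∀ z : S,
    ∫⁻ ω, A.meas ω (Icc r T) ^ q ∂(Z.P r z) < ∞ ∧
      ∀ᵐ ω ∂(Z.P r z), A.meas ω (Ioi T) = 0

end AdditiveFunctional

/-- `v` is progressive on `[0,T]`: for `0 ≤ r ≤ t ≤ T` and every `μ`, the map `(s,ω) ↦ v(s,Z_s(ω))`
on `[r,t] × Ω` is, up to a `P_{r,μ}`-null set of `ω`, measurable with respect to the product of the
Borel σ-algebra and `F [r,t]`.  (Every jointly Borel function `v` has this property.) -/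
def IsProgressive (Z : RightProcess S Ω) (T : ℝ≥0) (v : ℝ≥0 → S → ℝ≥0) : Prop :=
  ∀ r t : ℝ≥0, r ≤ t → t ≤ T → ∀ μ : Measure S, IsProbabilityMeasure μ →
    ∃ g : ℝ≥0 × Ω → ℝ≥0,
      Measurable[@Prod.instMeasurableSpace ℝ≥0 Ω _ (Z.F (Icc r t))] g ∧
        ∀ᵐ ω ∂(Z.law r μ), ∀ s ∈ Icc r t, v s (Z.X s ω) = g (s, ω)

/-- The `[0,∞]`-valued random variable `∫_r^T v(t,Z_t)^q L(dt)`. -/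
noncomputable def powIntegral (Z : RightProcess S Ω) (L : AdditiveFunctional Z) (T : ℝ≥0) (q : ℝ)
    (v : ℝ≥0 → S → ℝ≥0) (r : ℝ≥0) (ω : Ω) : ℝ≥0∞ :=
  ∫⁻ t in Icc r T, ((v t (Z.X t ω) ^ q : ℝ≥0) : ℝ≥0∞) ∂(L.meas ω)

/-- `v` (finite and nonnegative by its type) solves
`v(r,z) = E_{r,z}[A[r,T] - ∫_r^T v(t,Z_t)^q L(dt)]` for all `(r,z) ∈ [0,T] × S`.  For `A` with
`E_{r,z}[A[r,T]] < ∞` the expectation is a well-defined finite number exactly if the second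
term is integrable. -/
structure IsSolution (Z : RightProcess S Ω) (A L : AdditiveFunctional Z) (T : ℝ≥0) (q : ℝ)
    (v : ℝ≥0 → S → ℝ≥0) : Prop where
  progressive : IsProgressive Z T v
  integrable : ∀ r : ℝ≥0, r ≤ T → ∀ z : S, ∫⁻ ω, powIntegral Z L T q v r ω ∂(Z.P r z) < ∞
  equation : ∀ r : ℝ≥0, r ≤ T → ∀ z : S,
    (v r z : ℝ) =
      ∫ ω, ((A.meas ω (Icc r T)).toReal - (powIntegral Z L T q v r ω).toReal) ∂(Z.P r z)

end

/-!
The comparison is a Feynman–Kac argument for the equation linearized at `v'`.  Fix a starting point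
`(r,z)` and put `K(dt) = q v'(t,Z_t)^(q-1) L'(dt)` on `[r,T]`, `φ_t = exp(-K[r,t])` and
`κ(dt) = φ_t K(dt)`; thus `κ` is the law of the killing time of a particle killed at rate `K`, and
`κ[r,t] = 1 - φ_t`.

Integration by parts on the path gives `M[r,T] = ∫ M(s,T] κ(ds) + ∫ φ dM` for every finite measure
`M` (`measure_Icc_eq_killing`).  Apply this to `A` and to the absorption term `C = v^q L`, and
evaluate `E_{r,z}[∫ M(s,T] κ(ds)]` by replacing `M(s,T]` with its conditional expectation
`E_{s,Z_s}[M(s,T]]`.  The equation, used at all the points `(s,Z_s)`, then yields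

  `v(r,z) + E ∫ φ v^q dL ≤ E ∫ v(s,Z_s) κ(ds) + E ∫ φ dA`,

and the reverse inequality for `v'` (`IsSolution.add_le_killing`, `IsSolution.killing_le_add`).  Now
`κ = φ q v'^(q-1) L'`, and `q v'^(q-1) v ≤ v^q + (q-1) v'^q` because the graph of the power function
lies above its tangent at `v'` (`young_tangent`).  Together with `A ≤ A'` and `L' ≤ L` as measures on
`[r,T]`, the terms with `v^q` cancel and both solutions are separated by
`(q-1) E ∫ φ v'^q dL' + E ∫ φ dA'`.

Everything rests on the replacement of `M(s,T]` by its conditional expectation at the random times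
charged by `κ`, where the right property of the process enters.  For a function of `Z_t` the
conditional expectation is right-continuous in `s < t`, so that it may be discretized from the right;
as `κ` is adapted, the Markov property applies at each grid point
(`lintegral_compProd_of_rightContinuous`, `IsAdaptedClock.projection`).  Letting the later time
decrease to `s` gives the statement for the left-open tails `M(s,T]` of every adapted random measure
(`IsAdaptedClock.projection_tail`).  The absorption term has no atoms, so the left endpoint does not
matter for it.  For `A'` the closed tails `A'[s,T]` appear, and atoms at the time `s` could contribute
to the conditional expectation at exceptional times; this is excluded by membership in the class `𝒜`,
for which an upper bound passes through the defining limits (`MemClass.projection_le`).  In this way no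
path regularity of the solutions is needed.
-/

/-! ### Dyadic discretization of the half-line -/

/-- The index of the dyadic interval `[i 2⁻ⁿ, (i+1) 2⁻ⁿ)` that contains `s`. -/
noncomputable def dyadicIndex (n : ℕ) (s : ℝ≥0) : ℕ := ⌊2 ^ n * s⌋₊

/-- The dyadic number `i 2⁻ⁿ`. -/
noncomputable def dyadicPoint (n i : ℕ) : ℝ≥0 := i / 2 ^ n

/-- The right endpoint of the dyadic interval of level `n` that contains `s`. -/
noncomputable def dyadicCeil (n : ℕ) (s : ℝ≥0) : ℝ≥0 := dyadicPoint n (dyadicIndex n s + 1)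

theorem dyadicPoint_mono (n : ℕ) : Monotone (dyadicPoint n) := by
  intro i j h
  unfold dyadicPoint
  gcongr

theorem dyadicPoint_lt_succ (n i : ℕ) : dyadicPoint n i < dyadicPoint n (i + 1) := by
  unfold dyadicPoint
  gcongr
  simp

theorem dyadicPoint_index_le (n : ℕ) (s : ℝ≥0) : dyadicPoint n (dyadicIndex n s) ≤ s := by
  unfold dyadicPoint dyadicIndex
  rw [div_le_iff₀ (by positivity), mul_comm s]
  exact Nat.floor_le (by positivity)

theorem lt_dyadicCeil (n : ℕ) (s : ℝ≥0) : s < dyadicCeil n s := by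
  unfold dyadicCeil dyadicPoint dyadicIndex
  rw [lt_div_iff₀ (by positivity), mul_comm s]
  push_cast
  exact Nat.lt_floor_add_one _

theorem dyadicIndex_eq_iff (n i : ℕ) (s : ℝ≥0) :
    dyadicIndex n s = i ↔ s ∈ Ico (dyadicPoint n i) (dyadicPoint n (i + 1)) := by
  constructor
  · rintro rfl
    exact ⟨dyadicPoint_index_le n s, lt_dyadicCeil n s⟩
  · rintro ⟨h1, h2⟩
    unfold dyadicPoint at h1 h2
    unfold dyadicIndex
    rw [div_le_iff₀ (by positivity), mul_comm s] at h1
    rw [lt_div_iff₀ (by positivity), mul_comm s] at h2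
    rw [Nat.floor_eq_iff (by positivity)]
    exact ⟨h1, by push_cast at h2; exact h2⟩

theorem preimage_dyadicIndex (n i : ℕ) :
    dyadicIndex n ⁻¹' {i} = Ico (dyadicPoint n i) (dyadicPoint n (i + 1)) := by
  ext s
  exact dyadicIndex_eq_iff n i s

theorem measurable_dyadicIndex (n : ℕ) : Measurable (dyadicIndex n) :=
  Nat.measurable_floor.comp (measurable_const_mul _)

theorem dyadicPoint_double (n i : ℕ) : dyadicPoint (n + 1) (2 * i) = dyadicPoint n i := by
  unfold dyadicPoint
  push_cast
  rw [pow_succ, mul_comm]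
  exact mul_div_mul_right _ _ two_ne_zero

theorem two_mul_dyadicIndex_le (n : ℕ) (s : ℝ≥0) :
    2 * dyadicIndex n s ≤ dyadicIndex (n + 1) s := by
  unfold dyadicIndex
  refine Nat.le_floor ?_
  have := Nat.floor_le (a := 2 ^ n * s) (by positivity)
  push_cast
  calc (2 : ℝ≥0) * ⌊2 ^ n * s⌋₊ ≤ 2 * (2 ^ n * s) := by gcongr
    _ = _ := by ring

theorem dyadicIndex_succ_lt (n : ℕ) (s : ℝ≥0) :
    dyadicIndex (n + 1) s < 2 * (dyadicIndex n s + 1) := by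
  unfold dyadicIndex
  rw [Nat.floor_lt (by positivity)]
  have := Nat.lt_floor_add_one (2 ^ n * s)
  push_cast
  calc 2 ^ (n + 1) * s = 2 * (2 ^ n * s) := by ring
    _ < _ := by gcongr

theorem antitone_dyadicCeil (s : ℝ≥0) : Antitone fun n => dyadicCeil n s := by
  refine antitone_nat_of_succ_le fun n => ?_
  unfold dyadicCeil
  rw [← dyadicPoint_double n]
  exact dyadicPoint_mono _ (dyadicIndex_succ_lt n s)

theorem monotone_dyadicFloor (s : ℝ≥0) :
    Monotone fun n => dyadicPoint n (dyadicIndex n s) := by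
  refine monotone_nat_of_le_succ fun n => ?_
  rw [← dyadicPoint_double n]
  exact dyadicPoint_mono _ (two_mul_dyadicIndex_le n s)

theorem dyadicCeil_eq_add (n : ℕ) (s : ℝ≥0) :
    dyadicCeil n s = dyadicPoint n (dyadicIndex n s) + (1 / 2) ^ n := by
  unfold dyadicCeil dyadicPoint
  push_cast
  rw [add_div, one_div, one_div, inv_pow]

theorem tendsto_half_pow : Tendsto (fun n : ℕ => ((1 / 2 : ℝ≥0)) ^ n) atTop (𝓝 0) :=
  NNReal.tendsto_pow_atTop_nhds_zero_of_lt_one (by norm_num)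

theorem tendsto_dyadicCeil (s : ℝ≥0) : Tendsto (fun n => dyadicCeil n s) atTop (𝓝 s) := by
  have h : Tendsto (fun n : ℕ => s + (1 / 2 : ℝ≥0) ^ n) atTop (𝓝 s) := by
    simpa using tendsto_const_nhds.add tendsto_half_pow
  refine tendsto_of_tendsto_of_tendsto_of_le_of_le tendsto_const_nhds h
    (fun n => (lt_dyadicCeil n s).le) fun n => ?_
  dsimp only
  rw [dyadicCeil_eq_add]
  gcongr
  exact dyadicPoint_index_le n s

theorem tendsto_dyadicFloor (s : ℝ≥0) :
    Tendsto (fun n => dyadicPoint n (dyadicIndex n s)) atTop (𝓝 s) := by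
  have h := (tendsto_dyadicCeil s).sub tendsto_half_pow
  rw [tsub_zero] at h
  refine h.congr fun n => ?_
  rw [dyadicCeil_eq_add, add_tsub_cancel_right]

theorem eventually_dyadicCeil_lt {s t : ℝ≥0} (h : s < t) :
    ∀ᶠ n in atTop, dyadicCeil n s < t :=
  (tendsto_dyadicCeil s).eventually_lt_const h

/-! ### Measures on the half-line -/

/-- Finite measures on the half-line are ordered as soon as they are ordered on closed bounded
intervals: an open set is the increasing union of unions of dyadic intervals, and finite measures
are outer regular. -/
theorem measure_le_of_Icc {μ ν : Measure ℝ≥0} [IsFiniteMeasure ν]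
    (h : ∀ a b : ℝ≥0, a ≤ b → μ (Icc a b) ≤ ν (Icc a b)) : μ ≤ ν := by
  have hIco : ∀ a b : ℝ≥0, a < b → μ (Ico a b) ≤ ν (Ico a b) := by
    intro a b hab
    obtain ⟨u, hu, hub, hut⟩ := exists_seq_strictMono_tendsto' hab
    have hU : Ico a b = ⋃ n, Icc a (u n) := by
      ext x
      simp only [mem_Ico, mem_iUnion, mem_Icc]
      constructor
      · rintro ⟨h1, h2⟩
        obtain ⟨n, hn⟩ := (hut.eventually_const_lt h2).exists
        exact ⟨n, h1, hn.le⟩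
      · rintro ⟨n, h1, h2⟩
        exact ⟨h1, h2.trans_lt (hub n).2⟩
    have hmono : Monotone fun n => Icc a (u n) :=
      fun i j hij => Icc_subset_Icc_right (hu.monotone hij)
    rw [hU, hmono.measure_iUnion, hmono.measure_iUnion]
    exact iSup_mono fun n => h _ _ (hub n).1.le
  have hmap : ∀ n, ∀ S : Set ℕ, μ (dyadicIndex n ⁻¹' S) ≤ ν (dyadicIndex n ⁻¹' S) := by
    intro n S
    have hm : ∀ ρ : Measure ℝ≥0, ρ (dyadicIndex n ⁻¹' S)
        = ∑' i : S, ρ (Ico (dyadicPoint n i) (dyadicPoint n (i + 1))) := by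
      intro ρ
      have : dyadicIndex n ⁻¹' S = ⋃ i : S, dyadicIndex n ⁻¹' {(i : ℕ)} := by
        ext x; simp
      rw [this, measure_iUnion]
      · simp_rw [preimage_dyadicIndex]
      · intro i j hij
        refine Disjoint.preimage _ ?_
        simpa [Subtype.ext_iff] using hij
      · exact fun i => measurable_dyadicIndex n (measurableSet_singleton _)
    rw [hm, hm]
    exact ENNReal.tsum_le_tsum fun i => hIco _ _ (dyadicPoint_lt_succ _ _)
  have hopen : ∀ U : Set ℝ≥0, IsOpen U → μ U ≤ ν U := by
    intro U hU
    let W : ℕ → Set ℝ≥0 := fun n => dyadicIndex n ⁻¹'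
      {i | Ico (dyadicPoint n i) (dyadicPoint n (i + 1)) ⊆ U}
    have hWmono : Monotone W := by
      refine monotone_nat_of_le_succ fun n s hs => ?_
      simp only [W, mem_preimage, mem_ofPred_eq] at hs ⊢
      refine Subset.trans (Ico_subset_Ico ?_ ?_) hs
      · exact monotone_dyadicFloor s n.le_succ
      · exact antitone_dyadicCeil s n.le_succ
    have hWU : U = ⋃ n, W n := by
      ext s
      simp only [mem_iUnion]
      constructor
      · intro hs
        obtain ⟨ε, hε, hball⟩ := Metric.isOpen_iff.1 hU s hs
        have h2 : ∀ᶠ n : ℕ in atTop, ((1 / 2 : ℝ≥0)) ^ n < ⟨ε, hε.le⟩ :=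
          tendsto_half_pow.eventually_lt_const (by exact_mod_cast hε)
        obtain ⟨n, hn⟩ := h2.exists
        refine ⟨n, fun x hx => hball ?_⟩
        have e1 := dyadicCeil_eq_add n s
        have h3 := lt_dyadicCeil n s
        have h4 := dyadicPoint_index_le n s
        have h5 := hx.1
        have h6 : x < dyadicCeil n s := hx.2
        rw [e1] at h3 h6
        have hn' : (((1 / 2 : ℝ≥0) ^ n : ℝ≥0) : ℝ) < ε := hn
        rw [Metric.mem_ball, NNReal.dist_eq, abs_lt]
        have h3' := NNReal.coe_lt_coe.2 h3
        have h4' := NNReal.coe_le_coe.2 h4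
        have h5' := NNReal.coe_le_coe.2 h5
        have h6' := NNReal.coe_lt_coe.2 h6
        rw [NNReal.coe_add] at h3' h6'
        constructor <;> linarith
      · rintro ⟨n, hn⟩
        exact hn ⟨dyadicPoint_index_le n s, lt_dyadicCeil n s⟩
    rw [hWU, hWmono.measure_iUnion, hWmono.measure_iUnion]
    exact iSup_mono fun n => hmap n _
  rw [Measure.le_iff]
  intro B _
  rw [B.measure_eq_iInf_isOpen ν]
  exact le_iInf₂ fun U hBU => le_iInf fun hU => (measure_mono hBU).trans (hopen U hU)

theorem iSup_measure_Icc_dyadicCeil (M : Measure ℝ≥0) (s T : ℝ≥0) :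
    ⨆ n, M (Icc (dyadicCeil n s) T) = M (Ioc s T) := by
  have hmono : Monotone fun n => Icc (dyadicCeil n s) T :=
    fun i j hij => Icc_subset_Icc_left (antitone_dyadicCeil s hij)
  rw [← hmono.measure_iUnion]
  congr 1
  ext x
  simp only [mem_iUnion, mem_Icc, mem_Ioc]
  constructor
  · rintro ⟨n, h1, h2⟩
    exact ⟨(lt_dyadicCeil n s).trans_le h1, h2⟩
  · rintro ⟨h1, h2⟩
    obtain ⟨n, hn⟩ := (eventually_dyadicCeil_lt h1).exists
    exact ⟨n, hn.le, h2⟩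

theorem measure_le_of_Icc_le_of_Icc {M N : Measure ℝ≥0} {r T : ℝ≥0} (hN : N (Icc r T) ≠ ∞)
    (h : ∀ a b : ℝ≥0, r ≤ a → a ≤ b → b ≤ T → M (Icc a b) ≤ N (Icc a b)) :
    M.restrict (Icc r T) ≤ N.restrict (Icc r T) := by
  have : IsFiniteMeasure (N.restrict (Icc r T)) := ⟨by simpa using hN.lt_top⟩
  refine measure_le_of_Icc fun a b hab => ?_
  rw [Measure.restrict_apply measurableSet_Icc, Measure.restrict_apply measurableSet_Icc,
    Icc_inter_Icc]
  by_cases hc : a ⊔ r ≤ b ⊓ T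
  · exact h _ _ le_sup_right hc inf_le_right
  · simp [Icc_eq_empty hc]

theorem continuous_measureReal_Iic (μ : Measure ℝ≥0) [IsFiniteMeasure μ] [NullSingletonClass μ] :
    Continuous fun s => μ.real (Iic s) := by
  have h : (fun s => μ.real (Iic s)) = fun s => ∫ x, (Iic s).indicator (fun _ => (1 : ℝ)) x ∂μ := by
    ext s
    rw [integral_indicator measurableSet_Iic]
    simp
  rw [h, continuous_iff_continuousAt]
  intro s
  refine continuousAt_of_dominated (bound := fun _ => (1 : ℝ)) ?_ ?_ (integrable_const _) ?_
  · exact Eventually.of_forall fun t =>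
      (measurable_const.indicator measurableSet_Iic).aestronglyMeasurable
  · refine Eventually.of_forall fun t => Eventually.of_forall fun x => ?_
    by_cases hx : x ∈ Iic t <;> simp [hx]
  · have : ∀ᵐ x ∂μ, x ≠ s := by simp [ae_iff]
    filter_upwards [this] with x hx
    rcases lt_or_gt_of_ne hx with h1 | h1
    · refine (continuousAt_const (y := (1 : ℝ))).congr ?_
      filter_upwards [lt_mem_nhds h1] with t ht
      simp [ht.le]
    · refine (continuousAt_const (y := (0 : ℝ))).congr ?_
      filter_upwards [gt_mem_nhds h1] with t ht
      simp [ht]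

/-- A finite measure without atoms is carried to Lebesgue measure on `(0, μ univ]` by its
distribution function. -/
theorem map_measureReal_Iic (μ : Measure ℝ≥0) [IsFiniteMeasure μ] [NullSingletonClass μ] :
    μ.map (fun s => μ.real (Iic s)) = (volume : Measure ℝ).restrict (Ioc 0 (μ.real univ)) := by
  set F : ℝ≥0 → ℝ := fun s => μ.real (Iic s) with hF
  have hcont : Continuous F := continuous_measureReal_Iic μ
  have hmono : Monotone F := fun a b hab => measureReal_mono (Iic_subset_Iic.2 hab)
  have h0 : F 0 = 0 := by
    have : Iic (0 : ℝ≥0) = {0} := by ext x; simp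
    simp [hF, this, measureReal_def]
  have hle : ∀ s, F s ≤ μ.real univ := fun s => measureReal_mono (subset_univ _)
  have hlim : Tendsto F atTop (𝓝 (μ.real univ)) :=
    (ENNReal.tendsto_toReal (measure_ne_top _ _)).comp (tendsto_measure_Iic_atTop μ)
  have : IsFiniteMeasure ((volume : Measure ℝ).restrict (Ioc 0 (μ.real univ))) :=
    ⟨by simp⟩
  refine Measure.ext_of_Iic _ _ fun x => ?_
  rw [Measure.map_apply hcont.measurable measurableSet_Iic,
    Measure.restrict_apply measurableSet_Iic]
  have hset : Iic x ∩ Ioc 0 (μ.real univ) = Ioc 0 (min x (μ.real univ)) := by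
    ext y
    simp only [mem_inter_iff, mem_Iic, mem_Ioc, le_min_iff]
    tauto
  rw [hset, Real.volume_Ioc, sub_zero]
  rcases lt_or_ge x 0 with hx | hx
  · have : F ⁻¹' Iic x = ∅ := by
      ext s
      simp only [mem_preimage, mem_Iic, mem_empty_iff_false, iff_false, not_le]
      exact hx.trans_le measureReal_nonneg
    rw [this, measure_empty, ENNReal.ofReal_of_nonpos]
    exact (min_le_left _ _).trans hx.le
  -- By continuity, the distribution function takes every value between `0` and `F s`.
  have hivt : ∀ s y, 0 ≤ y → y ≤ F s → ∃ u, F u = y := by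
    intro s y hy hys
    have := intermediate_value_Icc (zero_le : 0 ≤ s) hcont.continuousOn
    rw [h0] at this
    obtain ⟨u, _, hu⟩ := this ⟨hy, hys⟩
    exact ⟨u, hu⟩
  have hFm : ∀ u, μ (Iic u) = ENNReal.ofReal (F u) := fun u => by
    simp [hF, measureReal_def]
  by_cases hs : ∃ s, x < F s
  · obtain ⟨s, hs⟩ := hs
    rw [min_eq_left (hs.le.trans (hle s))]
    apply le_antisymm
    · have key : ∀ y, x < y → y ≤ F s → μ (F ⁻¹' Iic x) ≤ ENNReal.ofReal y := by
        intro y hy hys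
        obtain ⟨u, hu⟩ := hivt s y (hx.trans hy.le) hys
        rw [← hu, ← hFm]
        refine measure_mono fun w hw => ?_
        by_contra hwu
        have := hmono (le_of_not_ge hwu)
        rw [hu] at this
        exact absurd (this.trans hw) (not_le.2 hy)
      have hconv : Tendsto (fun y => ENNReal.ofReal y) (𝓝[>] x) (𝓝 (ENNReal.ofReal x)) :=
        (ENNReal.continuous_ofReal.tendsto x).mono_left nhdsWithin_le_nhds
      refine ge_of_tendsto hconv ?_
      filter_upwards [Ioc_mem_nhdsGT hs] with y hy
      exact key y hy.1 hy.2
    · obtain ⟨u, hu⟩ := hivt s x hx hs.le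
      rw [← hu, ← hFm]
      exact measure_mono fun w hw => hmono hw
  · push Not at hs
    have : F ⁻¹' Iic x = univ := by ext s; simpa using hs s
    rw [this, min_eq_right (le_of_tendsto' hlim hs)]
    simp [measureReal_def]

theorem lintegral_exp_neg_measureReal_Iic (μ : Measure ℝ≥0) [IsFiniteMeasure μ] [NullSingletonClass μ] :
    ∫⁻ s, ENNReal.ofReal (Real.exp (-μ.real (Iic s))) ∂μ
      = ENNReal.ofReal (1 - Real.exp (-μ.real univ)) := by
  have hm : Measurable fun x : ℝ => ENNReal.ofReal (Real.exp (-x)) := by fun_prop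
  have h := lintegral_map (μ := μ) hm (continuous_measureReal_Iic μ).measurable
  rw [map_measureReal_Iic] at h
  rw [← h, ← ofReal_integral_eq_lintegral_ofReal]
  · congr 1
    rw [← intervalIntegral.integral_of_le measureReal_nonneg]
    rw [intervalIntegral.integral_comp_neg (fun x : ℝ => Real.exp x)]
    simp [integral_exp]
  · exact (Continuous.integrableOn_Icc (by fun_prop)).mono_set Ioc_subset_Icc_self
  · exact Eventually.of_forall fun x => (Real.exp_pos _).le

/-- The density `exp(-K[0,s])` with respect to a measure `K`: the survival function of a particle
that is killed at rate `K`. -/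
noncomputable def survival (K : Measure ℝ≥0) (s : ℝ≥0) : ℝ≥0∞ :=
  ENNReal.ofReal (Real.exp (-K.real (Iic s)))

/-- The law of the killing time of a particle that is killed at rate `K`. -/
noncomputable def killingTime (K : Measure ℝ≥0) : Measure ℝ≥0 := K.withDensity (survival K)

theorem measurable_survival (K : Measure ℝ≥0) [IsFiniteMeasure K] : Measurable (survival K) := by
  have : Antitone (survival K) := fun a b hab => by
    unfold survival
    gcongr
    exact measure_ne_top _ _
  exact this.measurable

theorem killingTime_Iic (K : Measure ℝ≥0) [IsFiniteMeasure K] [NullSingletonClass K] (t : ℝ≥0) :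
    killingTime K (Iic t) = 1 - survival K t := by
  have h := lintegral_exp_neg_measureReal_Iic (K.restrict (Iic t))
  have h2 : ∀ s ∈ Iic t, (K.restrict (Iic t)).real (Iic s) = K.real (Iic s) := by
    intro s hs
    rw [measureReal_def, Measure.restrict_apply measurableSet_Iic, Iic_inter_Iic,
      min_eq_left hs, measureReal_def]
  rw [killingTime, withDensity_apply _ measurableSet_Iic]
  rw [setLIntegral_congr_fun measurableSet_Iic
    (g := fun s => ENNReal.ofReal (Real.exp (-(K.restrict (Iic t)).real (Iic s)))), h]
  · simp [survival, ENNReal.ofReal_sub _ (Real.exp_pos _).le, measureReal_restrict_apply]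
  · intro s hs
    dsimp only
    rw [h2 s hs, survival]

theorem survival_le_one (K : Measure ℝ≥0) (s : ℝ≥0) : survival K s ≤ 1 := by
  unfold survival
  rw [ENNReal.ofReal_le_one, Real.exp_le_one_iff]
  simp

theorem killingTime_univ_le (K : Measure ℝ≥0) [IsFiniteMeasure K] [NullSingletonClass K] :
    killingTime K univ ≤ 1 := by
  have := tendsto_measure_Iic_atTop (killingTime K)
  refine le_of_tendsto' this fun t => ?_
  rw [killingTime_Iic]
  exact tsub_le_self

instance (K : Measure ℝ≥0) [NullSingletonClass K] : NullSingletonClass (killingTime K) := by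
  unfold killingTime
  infer_instance

theorem killingTime_Iio (K : Measure ℝ≥0) [IsFiniteMeasure K] [NullSingletonClass K] (t : ℝ≥0) :
    killingTime K (Iio t) = 1 - survival K t := by
  rw [← killingTime_Iic]
  exact measure_congr Iio_ae_eq_Iic

theorem lintegral_measure_Ioi_eq (κ M : Measure ℝ≥0) [SFinite κ] [SFinite M] :
    ∫⁻ s, M (Ioi s) ∂κ = ∫⁻ t, κ (Iio t) ∂M := by
  have hA : MeasurableSet {p : ℝ≥0 × ℝ≥0 | p.1 < p.2} :=
    measurableSet_lt measurable_fst measurable_snd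
  have h1 := Measure.prod_apply (μ := κ) (ν := M) hA
  rw [Measure.prod_apply_symm hA] at h1
  exact h1.symm

/-- Integration by parts: the mass of `M` splits according to whether it comes after or before the
killing time. -/
theorem measure_univ_eq_killing (K M : Measure ℝ≥0) [IsFiniteMeasure K] [NullSingletonClass K]
    [SFinite M] :
    M univ = ∫⁻ s, M (Ioi s) ∂(killingTime K) + ∫⁻ t, survival K t ∂M := by
  have : IsFiniteMeasure (killingTime K) :=
    ⟨(killingTime_univ_le K).trans_lt ENNReal.one_lt_top⟩
  rw [lintegral_measure_Ioi_eq, ← lintegral_add_right _ (measurable_survival K)]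
  simp_rw [killingTime_Iio, tsub_add_cancel_of_le (survival_le_one K _)]
  simp

/-- An atomless measure does not charge the countably many atoms of `M`. -/
theorem lintegral_measure_Ici_eq (κ M : Measure ℝ≥0) [NullSingletonClass κ] [SFinite M] :
    ∫⁻ s, M (Ici s) ∂κ = ∫⁻ s, M (Ioi s) ∂κ := by
  have hc : {s | 0 < M {s}}.Countable :=
    Measure.countable_meas_pos_of_disjoint_iUnion (fun s => measurableSet_singleton s)
      (fun i j hij => by simpa using hij)
  refine lintegral_congr_ae ?_
  have := hc.measure_zero κ
  filter_upwards [measure_eq_zero_iff_ae_notMem.1 this] with s hs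
  have h0 : M {s} = 0 := by simpa using hs
  rw [← Ioi_insert, insert_eq]
  refine le_antisymm ((measure_union_le _ _).trans (by simp [h0])) (measure_mono subset_union_right)

/-! ### Measurability up to null sets with respect to a sub-σ-algebra -/

/-- `f` coincides `P`-almost surely with an `m`-measurable function. -/
def HasVersion {Ω : Type*} (m : MeasurableSpace Ω) {m0 : MeasurableSpace Ω} (P : Measure Ω)
    (f : Ω → ℝ≥0∞) : Prop :=
  ∃ g : Ω → ℝ≥0∞, Measurable[m] g ∧ ∀ᵐ ω ∂P, f ω = g ω

namespace HasVersion

variable {Ω : Type*} {m0 m : MeasurableSpace Ω} {P : @Measure Ω m0} {f g : Ω → ℝ≥0∞}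

theorem of_measurable (hf : Measurable[m] f) : HasVersion m P f :=
  ⟨f, hf, Eventually.of_forall fun _ => rfl⟩

theorem congr (hf : HasVersion m P f) (h : ∀ᵐ ω ∂P, g ω = f ω) : HasVersion m P g := by
  obtain ⟨f', h1, h2⟩ := hf
  exact ⟨f', h1, by filter_upwards [h, h2] with ω a b using a.trans b⟩

theorem mono {m' : MeasurableSpace Ω} (hf : HasVersion m P f) (h : m ≤ m') :
    HasVersion m' P f := by
  obtain ⟨f', h1, h2⟩ := hf
  exact ⟨f', h1.mono h le_rfl, h2⟩

theorem aemeasurable (hf : HasVersion m P f) (h : m ≤ m0) : AEMeasurable f P := by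
  obtain ⟨f', h1, h2⟩ := hf
  exact ⟨f', h1.mono h le_rfl, h2⟩

theorem comp (hf : HasVersion m P f) {φ : ℝ≥0∞ → ℝ≥0∞} (hφ : Measurable φ) :
    HasVersion m P fun ω => φ (f ω) := by
  obtain ⟨f', h1, h2⟩ := hf
  exact ⟨_, hφ.comp h1, by filter_upwards [h2] with ω a using congrArg φ a⟩

theorem add (hf : HasVersion m P f) (hg : HasVersion m P g) :
    HasVersion m P fun ω => f ω + g ω := by
  obtain ⟨f', h1, h2⟩ := hf
  obtain ⟨g', h3, h4⟩ := hg
  exact ⟨_, h1.add h3, by filter_upwards [h2, h4] with ω a b; simp [a, b]⟩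

theorem sub (hf : HasVersion m P f) (hg : HasVersion m P g) :
    HasVersion m P fun ω => f ω - g ω := by
  obtain ⟨f', h1, h2⟩ := hf
  obtain ⟨g', h3, h4⟩ := hg
  exact ⟨_, h1.sub h3, by filter_upwards [h2, h4] with ω a b; simp [a, b]⟩

theorem indicator (hf : HasVersion m P f) {B : Set Ω} (hB : MeasurableSet[m] B) :
    HasVersion m P (B.indicator f) := by
  obtain ⟨f', h1, h2⟩ := hf
  exact ⟨B.indicator f', h1.indicator hB, by
    filter_upwards [h2] with ω a; simp [Set.indicator, a]⟩

theorem tsum {f : ℕ → Ω → ℝ≥0∞} (hf : ∀ n, HasVersion m P (f n)) :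
    HasVersion m P fun ω => ∑' n, f n ω := by
  choose f' h1 h2 using hf
  exact ⟨fun ω => ∑' n, f' n ω, Measurable.tsum h1, by
    filter_upwards [ae_all_iff.2 h2] with ω a; simp [a]⟩

theorem iSup {f : ℕ → Ω → ℝ≥0∞} (hf : ∀ n, HasVersion m P (f n)) :
    HasVersion m P fun ω => ⨆ n, f n ω := by
  choose f' h1 h2 using hf
  exact ⟨fun ω => ⨆ n, f' n ω, Measurable.iSup h1, by
    filter_upwards [ae_all_iff.2 h2] with ω a; simp [a]⟩

theorem limsup {f : ℕ → Ω → ℝ≥0∞} (hf : ∀ n, HasVersion m P (f n)) :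
    HasVersion m P fun ω => Filter.limsup (fun n => f n ω) atTop := by
  choose f' h1 h2 using hf
  exact ⟨fun ω => Filter.limsup (fun n => f' n ω) atTop, Measurable.limsup h1, by
    filter_upwards [ae_all_iff.2 h2] with ω a; simp [a]⟩

end HasVersion

theorem isCountablySpanning_Icc :
    IsCountablySpanning {S : Set ℝ≥0 | ∃ l u, l ≤ u ∧ Icc l u = S} := by
  refine ⟨fun n => Icc 0 n, fun n => ⟨0, n, zero_le, rfl⟩, ?_⟩
  ext x
  simp only [mem_iUnion, mem_Icc, zero_le, true_and, mem_univ, iff_true]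
  exact exists_nat_ge x

/-- If the masses of the intervals `[s,t] ⊆ [a,b]` under a random measure are `m`-measurable up to
null sets, then so are the integrals of jointly measurable functions over `[a,b]`. -/
theorem hasVersion_lintegral {Ω : Type*} {m0 : MeasurableSpace Ω} [m : MeasurableSpace Ω]
    {P : @Measure Ω m0} {M : Ω → Measure ℝ≥0} {a b : ℝ≥0}
    (hfin : ∀ᵐ ω ∂P, M ω (Icc a b) < ∞)
    (h : ∀ s t, a ≤ s → s ≤ t → t ≤ b → HasVersion m P (fun ω => M ω (Icc s t)))
    {f : ℝ≥0 × Ω → ℝ≥0∞} (hf : Measurable f) :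
    HasVersion m P fun ω => ∫⁻ s in Icc a b, f (s, ω) ∂(M ω) := by
  have hall : ∀ s t, a ≤ s → t ≤ b → HasVersion m P (fun ω => M ω (Icc s t)) := by
    intro s t hs ht
    by_cases hst : s ≤ t
    · exact h s t hs hst ht
    · simp only [Icc_eq_empty hst, measure_empty]
      exact HasVersion.of_measurable measurable_const
  have hset : ∀ E : Set (ℝ≥0 × Ω), MeasurableSet E →
      HasVersion m P fun ω => M ω ((fun s => (s, ω)) ⁻¹' E ∩ Icc a b) := by
    have hgen := generateFrom_eq_prod (C := {S : Set ℝ≥0 | ∃ l u, l ≤ u ∧ Icc l u = S})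
      (D := {B : Set Ω | MeasurableSet B})
      ((borel_eq_generateFrom_Icc ℝ≥0).symm.trans (BorelSpace.measurable_eq).symm)
      MeasurableSpace.generateFrom_measurableSet isCountablySpanning_Icc
      isCountablySpanning_measurableSet
    have hpi : IsPiSystem {S : Set ℝ≥0 | ∃ l u, l ≤ u ∧ Icc l u = S} := by
      simpa using isPiSystem_Icc (id : ℝ≥0 → ℝ≥0) id
    intro E hE
    induction E, hE using MeasurableSpace.induction_on_inter hgen.symm
      (hpi.prod MeasurableSpace.isPiSystem_measurableSet) with
    | empty =>
      simp only [preimage_empty, empty_inter, measure_empty]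
      exact HasVersion.of_measurable measurable_const
    | basic E hE =>
      obtain ⟨_, ⟨l, u, -, rfl⟩, B, hB, rfl⟩ := hE
      replace hB : MeasurableSet B := hB
      refine ((hall (l ⊔ a) (u ⊓ b) le_sup_right inf_le_right).indicator hB).congr
        (Eventually.of_forall fun ω => ?_)
      by_cases hω : ω ∈ B
      · simp [hω, mk_preimage_prod_left, Icc_inter_Icc]
      · simp [hω]
    | compl E hE ih =>
      refine ((hall a b le_rfl le_rfl).sub ih).congr ?_
      filter_upwards [hfin] with ω hω
      have hm : MeasurableSet ((fun s => (s, ω)) ⁻¹' E) := measurable_prodMk_right hE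
      rw [← measure_sdiff inter_subset_right (hm.inter measurableSet_Icc).nullMeasurableSet
        ((measure_mono inter_subset_right).trans_lt hω).ne]
      congr 1
      ext s
      simp only [mem_inter_iff, mem_preimage, mem_compl_iff, Set.mem_sdiff]
      tauto
    | iUnion E hd hE ih =>
      refine (HasVersion.tsum ih).congr (Eventually.of_forall fun ω => ?_)
      rw [preimage_iUnion, iUnion_inter, measure_iUnion]
      · intro i j hij
        exact ((hd hij).preimage _).mono inter_subset_left inter_subset_left
      · exact fun i => (measurable_prodMk_right (hE i)).inter measurableSet_Icc
  refine Measurable.ennreal_induction (motive := fun f => HasVersion m P fun ω =>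
    ∫⁻ s in Icc a b, f (s, ω) ∂(M ω)) ?_ ?_ ?_ hf
  · intro c E hE
    refine ((hset E hE).comp (measurable_const_mul c)).congr (Eventually.of_forall fun ω => ?_)
    have hm : MeasurableSet ((fun s => (s, ω)) ⁻¹' E) := measurable_prodMk_right hE
    have : ∀ s, E.indicator (fun _ => c) (s, ω)
        = ((fun s => (s, ω)) ⁻¹' E).indicator (fun _ => c) s := fun s => rfl
    simp_rw [this]
    rw [lintegral_indicator_const hm, Measure.restrict_apply hm]
  · intro f g _ hf hg ihf ihg
    refine (ihf.add ihg).congr (Eventually.of_forall fun ω => ?_)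
    exact lintegral_add_left (f := fun s => f (s, ω)) (hf.comp measurable_prodMk_right) _
  · intro f hf hmono ih
    refine (HasVersion.iSup ih).congr (Eventually.of_forall fun ω => ?_)
    exact lintegral_iSup (f := fun n s => f n (s, ω))
      (fun n => (hf n).comp measurable_prodMk_right) fun i j hij s => hmono hij _

/-- A random measure of total mass at most one whose distribution function is almost everywhere
measurable coincides almost surely with a kernel. -/
theorem exists_kernel_ae_eq {Ω : Type*} [MeasurableSpace Ω] {P : Measure Ω}
    {M : Ω → Measure ℝ≥0} (h1 : ∀ᵐ ω ∂P, M ω univ ≤ 1)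
    (h : ∀ t, AEMeasurable (fun ω => M ω (Iic t)) P) :
    ∃ κ : Kernel Ω ℝ≥0, IsFiniteKernel κ ∧ ∀ᵐ ω ∂P, κ ω = M ω := by
  choose g hg1 hg2 using h
  have hae : ∀ᵐ ω ∂P, M ω univ ≤ 1 ∧
      ∀ n i, M ω (Iic (dyadicPoint n i)) = g (dyadicPoint n i) ω := by
    filter_upwards [h1, ae_all_iff.2 fun n => ae_all_iff.2 fun i => hg2 (dyadicPoint n i)]
      with ω a b using ⟨a, b⟩
  obtain ⟨N, hN, hNm, hN0⟩ := exists_measurable_superset_of_null (ae_iff.1 hae)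
  have hgood : ∀ ω ∉ N, M ω univ ≤ 1 ∧
      ∀ n i, M ω (Iic (dyadicPoint n i)) = g (dyadicPoint n i) ω := by
    intro ω hω
    by_contra hc
    exact hω (hN hc)
  classical
  let K : Ω → Measure ℝ≥0 := fun ω => if ω ∈ N then 0 else M ω
  have hK1 : ∀ ω, K ω univ ≤ 1 := by
    intro ω
    by_cases hω : ω ∈ N
    · simp [K, hω]
    · simpa [K, hω] using (hgood ω hω).1
  have : ∀ ω, IsFiniteMeasure (K ω) := fun ω => ⟨(hK1 ω).trans_lt ENNReal.one_lt_top⟩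
  have hd : ∀ n i, Measurable fun ω => K ω (Iic (dyadicPoint n i)) := by
    intro n i
    have : (fun ω => K ω (Iic (dyadicPoint n i)))
        = fun ω => if ω ∈ N then 0 else g (dyadicPoint n i) ω := by
      ext ω
      by_cases hω : ω ∈ N
      · simp [K, hω]
      · simp [K, hω, (hgood ω hω).2 n i]
    rw [this]
    exact Measurable.ite hNm measurable_const (hg1 _)
  have hKm : Measurable K := by
    refine Measurable.measure_of_isPiSystem (S := range Iic)
      ((BorelSpace.measurable_eq).trans (borel_eq_generateFrom_Iic ℝ≥0)) isPiSystem_Iic ?_ ?_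
    · rintro _ ⟨t, rfl⟩
      have : Iic t = ⋂ n, Iic (dyadicCeil n t) := by
        ext s
        simp only [mem_Iic, mem_iInter]
        exact ⟨fun hs n => hs.trans (lt_dyadicCeil n t).le,
          fun hs => ge_of_tendsto' (tendsto_dyadicCeil t) hs⟩
      have hlim : ∀ ω, Tendsto (fun n => K ω (Iic (dyadicCeil n t))) atTop (𝓝 (K ω (Iic t))) := by
        intro ω
        rw [this]
        exact tendsto_measure_iInter_atTop (fun n => measurableSet_Iic.nullMeasurableSet)
          (fun i j hij => Iic_subset_Iic.2 (antitone_dyadicCeil t hij)) ⟨0, measure_ne_top _ _⟩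
      exact measurable_of_tendsto_metrizable (fun n => hd n _) (tendsto_pi_nhds.2 hlim)
    · have hlim : ∀ ω, Tendsto (fun n => K ω (Iic (dyadicPoint 0 n))) atTop (𝓝 (K ω univ)) := by
        intro ω
        have : univ = ⋃ n, Iic (dyadicPoint 0 n) := by
          ext s
          simpa [dyadicPoint] using exists_nat_ge s
        rw [this]
        exact tendsto_measure_iUnion_atTop fun i j hij => Iic_subset_Iic.2 (dyadicPoint_mono 0 hij)
      exact measurable_of_tendsto_metrizable (fun n => hd 0 n) (tendsto_pi_nhds.2 hlim)
  refine ⟨⟨K, hKm⟩, ⟨1, ENNReal.one_lt_top, hK1⟩, ?_⟩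
  filter_upwards [measure_eq_zero_iff_ae_notMem.1 hN0] with ω hω
  change K ω = M ω
  simp [K, hω]

/-! ### Integrating a right-continuous process against an adapted random measure -/

section Discretization

variable {Ω : Type*} [MeasurableSpace Ω] {P : Measure Ω} [IsFiniteMeasure P]
  {κ : Kernel Ω ℝ≥0} [IsFiniteKernel κ]

theorem ae_compProd_of_ae_fst {p : Ω → Prop} (h : ∀ᵐ ω ∂P, p ω) :
    ∀ᵐ q ∂(P ⊗ₘ κ), p q.1 := by
  obtain ⟨N, hN, hNm, hN0⟩ := exists_measurable_superset_of_null (ae_iff.1 h)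
  have hQ : ∀ᵐ q ∂(P ⊗ₘ κ), q.1 ∈ Nᶜ := by
    refine (Measure.ae_compProd_iff (p := fun q : Ω × ℝ≥0 => q.1 ∈ Nᶜ)
      (measurable_fst hNm.compl)).2 ?_
    filter_upwards [measure_eq_zero_iff_ae_notMem.1 hN0] with ω hω
    exact Eventually.of_forall fun s => hω
  filter_upwards [hQ] with q hq
  by_contra hc
  exact hq (hN hc)

theorem measurable_uncurry_dyadicIndex (n : ℕ) {Y : ℕ → Ω → ℝ≥0∞} (hY : ∀ i, Measurable (Y i)) :
    Measurable fun p : Ω × ℝ≥0 => Y (dyadicIndex n p.2) p.1 :=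
  (measurable_from_prod_countable_left (f := fun p : Ω × ℕ => Y p.2 p.1) hY).comp
    (measurable_fst.prodMk ((measurable_dyadicIndex n).comp measurable_snd))

theorem lintegral_compProd_dyadicIndex (n : ℕ) {Y : ℕ → Ω → ℝ≥0∞} (hY : ∀ i, Measurable (Y i)) :
    ∫⁻ p, Y (dyadicIndex n p.2) p.1 ∂(P ⊗ₘ κ)
      = ∑' i, ∫⁻ ω, Y i ω * κ ω (Ico (dyadicPoint n i) (dyadicPoint n (i + 1))) ∂P := by
  rw [Measure.lintegral_compProd (measurable_uncurry_dyadicIndex n hY), ← lintegral_tsum]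
  · refine lintegral_congr fun ω => ?_
    rw [← lintegral_map (f := fun i => Y i ω) (measurable_from_nat) (measurable_dyadicIndex n),
      lintegral_countable']
    simp_rw [Measure.map_apply (measurable_dyadicIndex n) (measurableSet_singleton _),
      preimage_dyadicIndex]
  · exact fun i => ((hY i).mul (κ.measurable_coe measurableSet_Ico)).aemeasurable

/-- Let `G` be right-continuous on `[a,t)` and let `G s` be, for each `s`, the projection of `Y` as
far as the masses `κ [s',s)` can see.  Then `G` may replace `Y` under the integral over `[a,t)`
with respect to `κ`. -/
theorem lintegral_compProd_of_rightContinuous {a t : ℝ≥0} {G : ℝ≥0 → Ω → ℝ≥0∞} {Y : Ω → ℝ≥0∞}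
    {c : ℝ≥0} (hGm : ∀ s ∈ Ico a t, Measurable (G s)) (hGc : ∀ s ∈ Ico a t, ∀ ω, G s ω ≤ c)
    (hYm : Measurable Y) (hYc : ∀ ω, Y ω ≤ c)
    (hG : ∀ᵐ ω ∂P, ∀ s ∈ Ico a t, ContinuousWithinAt (fun s' => G s' ω) (Ici s) s)
    (hproj : ∀ s' s, s' < s → s ∈ Ico a t →
      ∫⁻ ω, G s ω * κ ω (Ico s' s) ∂P = ∫⁻ ω, Y ω * κ ω (Ico s' s) ∂P) :
    AEMeasurable (fun p : Ω × ℝ≥0 => (Ico a t).indicator (fun s => G s p.1) p.2) (P ⊗ₘ κ) ∧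
    ∫⁻ p, (Ico a t).indicator (fun s => G s p.1) p.2 ∂(P ⊗ₘ κ)
      = ∫⁻ ω, Y ω * κ ω (Ico a t) ∂P := by
  let X : ℕ → ℕ → Ω → ℝ≥0∞ := fun n i => (Ico a t).indicator G (dyadicPoint n (i + 1))
  let Z : ℕ → ℕ → Ω → ℝ≥0∞ := fun n i =>
    (Ico a t).indicator (fun _ => Y) (dyadicPoint n (i + 1))
  have hX : ∀ n i, Measurable (X n i) := by
    intro n i
    by_cases hs : dyadicPoint n (i + 1) ∈ Ico a t
    · simpa [X, hs] using hGm _ hs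
    · simp only [X, hs, not_false_eq_true, indicator_of_notMem]
      exact measurable_const
  have hZ : ∀ n i, Measurable (Z n i) := by
    intro n i
    by_cases hs : dyadicPoint n (i + 1) ∈ Ico a t
    · simpa [Z, hs] using hYm
    · simp only [Z, hs, not_false_eq_true, indicator_of_notMem]
      exact measurable_const
  have hXZ : ∀ n, ∫⁻ p, X n (dyadicIndex n p.2) p.1 ∂(P ⊗ₘ κ)
      = ∫⁻ p, Z n (dyadicIndex n p.2) p.1 ∂(P ⊗ₘ κ) := by
    intro n
    rw [lintegral_compProd_dyadicIndex n (hX n), lintegral_compProd_dyadicIndex n (hZ n)]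
    refine tsum_congr fun i => ?_
    by_cases hs : dyadicPoint n (i + 1) ∈ Ico a t
    · simpa [X, Z, hs] using hproj _ _ (dyadicPoint_lt_succ n i) hs
    · simp [X, Z, hs]
  -- The grid point to the right of `s` lies in `[a,t)` eventually if and only if `s` does.
  have hev : ∀ s, ∀ᶠ n in atTop, (dyadicCeil n s ∈ Ico a t ↔ s ∈ Ico a t) := by
    intro s
    rcases lt_or_ge s a with hsa | hsa
    · filter_upwards [eventually_dyadicCeil_lt hsa] with n hn
      exact ⟨fun h => absurd h.1 (not_le.2 hn), fun h => absurd h.1 (not_le.2 hsa)⟩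
    rcases lt_or_ge s t with hst | hst
    · filter_upwards [eventually_dyadicCeil_lt hst] with n hn
      exact ⟨fun _ => ⟨hsa, hst⟩, fun _ => ⟨hsa.trans (lt_dyadicCeil n s).le, hn⟩⟩
    · refine Eventually.of_forall fun n => ⟨fun h => ?_, fun h => ?_⟩
      · exact absurd (h.2.trans_le hst) (not_lt.2 (lt_dyadicCeil n s).le)
      · exact absurd h.2 (not_lt.2 hst)
  have hXlim : ∀ᵐ p ∂(P ⊗ₘ κ), Tendsto (fun n => X n (dyadicIndex n p.2) p.1) atTop
      (𝓝 ((Ico a t).indicator (fun s => G s p.1) p.2)) := by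
    filter_upwards [ae_compProd_of_ae_fst hG] with p hp'
    by_cases hs : p.2 ∈ Ico a t
    · have h1 : Tendsto (fun n => dyadicCeil n p.2) atTop (𝓝[≥] p.2) :=
        tendsto_nhdsWithin_iff.2 ⟨tendsto_dyadicCeil _,
          Eventually.of_forall fun n => (lt_dyadicCeil n p.2).le⟩
      simp only [hs, indicator_of_mem]
      refine ((hp' _ hs).tendsto.comp h1).congr' ?_
      filter_upwards [hev p.2] with n hn
      have : dyadicPoint n (dyadicIndex n p.2 + 1) ∈ Ico a t := hn.2 hs
      simp [X, this, dyadicCeil]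
    · simp only [hs, not_false_eq_true, indicator_of_notMem]
      refine tendsto_const_nhds.congr' ?_
      filter_upwards [hev p.2] with n hn
      have : dyadicPoint n (dyadicIndex n p.2 + 1) ∉ Ico a t := fun h => hs (hn.1 h)
      simp [X, this]
  have hZlim : ∀ p : Ω × ℝ≥0, Tendsto (fun n => Z n (dyadicIndex n p.2) p.1) atTop
      (𝓝 ((Ico a t).indicator (fun _ => Y p.1) p.2)) := by
    intro p
    refine tendsto_const_nhds.congr' ?_
    filter_upwards [hev p.2] with n hn
    have hn' : dyadicPoint n (dyadicIndex n p.2 + 1) ∈ Ico a t ↔ p.2 ∈ Ico a t := hn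
    by_cases hs : p.2 ∈ Ico a t
    · simp [Z, hs, hn'.2 hs]
    · simp [Z, hs, mt hn'.1 hs]
  have hbd : ∫⁻ _ : Ω × ℝ≥0, (c : ℝ≥0∞) ∂(P ⊗ₘ κ) ≠ ∞ := by
    rw [lintegral_const]
    exact ENNReal.mul_ne_top ENNReal.coe_ne_top (measure_ne_top _ _)
  have hXm : ∀ n, Measurable fun p : Ω × ℝ≥0 => X n (dyadicIndex n p.2) p.1 :=
    fun n => measurable_uncurry_dyadicIndex n (hX n)
  have hZm : ∀ n, Measurable fun p : Ω × ℝ≥0 => Z n (dyadicIndex n p.2) p.1 :=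
    fun n => measurable_uncurry_dyadicIndex n (hZ n)
  have hXc : ∀ n (p : Ω × ℝ≥0), X n (dyadicIndex n p.2) p.1 ≤ c := by
    intro n p
    by_cases hs : dyadicPoint n (dyadicIndex n p.2 + 1) ∈ Ico a t
    · simpa [X, hs] using hGc _ hs p.1
    · simp [X, hs]
  have hZc : ∀ n (p : Ω × ℝ≥0), Z n (dyadicIndex n p.2) p.1 ≤ c := by
    intro n p
    by_cases hs : dyadicPoint n (dyadicIndex n p.2 + 1) ∈ Ico a t
    · simpa [Z, hs] using hYc p.1
    · simp [Z, hs]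
  refine ⟨aemeasurable_of_tendsto_metrizable_ae atTop (fun n => (hXm n).aemeasurable) hXlim, ?_⟩
  have h1 := tendsto_lintegral_of_dominated_convergence (fun _ => (c : ℝ≥0∞)) hXm
    (fun n => Eventually.of_forall (hXc n)) hbd hXlim
  have h2 := tendsto_lintegral_of_dominated_convergence (fun _ => (c : ℝ≥0∞)) hZm
    (fun n => Eventually.of_forall (hZc n)) hbd (Eventually.of_forall hZlim)
  simp_rw [hXZ] at h1
  rw [tendsto_nhds_unique h1 h2, Measure.lintegral_compProd]
  · refine lintegral_congr fun ω => ?_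
    exact lintegral_indicator_const measurableSet_Ico (Y ω)
  · have : (fun p : Ω × ℝ≥0 => (Ico a t).indicator (fun _ => Y p.1) p.2)
        = (Prod.snd ⁻¹' Ico a t).indicator fun p => Y p.1 := by
      ext p; rfl
    rw [this]
    exact (hYm.comp measurable_fst).indicator (measurable_snd measurableSet_Ico)

end Discretization

/-! ### The Markov property -/

namespace MarkovProcess

variable {S Ω : Type*} [MeasurableSpace S] (Z : MarkovProcess S Ω)

theorem F_Ici_le {r t : ℝ≥0} (h : r ≤ t) : Z.F (Ici t) ≤ Z.F (Ici r) :=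
  Z.F_mono _ _ (Ici_subset_Ici.2 h)

theorem F_Icc_le {r s : ℝ≥0} (h : r ≤ s) (t : ℝ≥0) : Z.F (Icc s t) ≤ Z.F (Ici r) :=
  Z.F_mono _ _ fun _ hx => h.trans hx.1

theorem measurable_X {r t : ℝ≥0} (h : r ≤ t) : Measurable[Z.F (Ici r)] (Z.X t) :=
  (Z.X_measurable t).mono (Z.F_mono _ _ (by simpa using h)) le_rfl

instance isProbabilityMeasure_P (r : ℝ≥0) (z : S) : IsProbabilityMeasure (Z.P r z) :=
  ⟨Z.P_univ r z⟩

theorem measurable_lintegral_P {t : ℝ≥0} {h : Ω → ℝ≥0∞} (hh : Measurable[Z.F (Ici t)] h) :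
    Measurable fun y => ∫⁻ ω, h ω ∂(Z.P t y) :=
  @Measurable.lintegral_kernel _ _ _ (Z.F (Ici t)) (Z.P t) h hh

theorem measurable_lintegral_P_X {r t : ℝ≥0} (hrt : r ≤ t) {h : Ω → ℝ≥0∞}
    (hh : Measurable[Z.F (Ici t)] h) :
    Measurable[Z.F (Ici r)] fun ω => ∫⁻ ω', h ω' ∂(Z.P t (Z.X t ω)) :=
  (Z.measurable_lintegral_P hh).comp (Z.measurable_X hrt)

theorem setLIntegral_markov {r t : ℝ≥0} (hrt : r ≤ t) (z : S) {B : Set Ω}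
    (hB : MeasurableSet[Z.F (Icc r t)] B) {h : Ω → ℝ≥0∞} (hh : Measurable[Z.F (Ici t)] h) :
    ∫⁻ ω in B, h ω ∂(Z.P r z) = ∫⁻ ω in B, ∫⁻ ω', h ω' ∂(Z.P t (Z.X t ω)) ∂(Z.P r z) := by
  have hle := Z.F_Ici_le hrt
  refine @Measurable.ennreal_induction _ (Z.F (Ici t))
    (fun h => ∫⁻ ω in B, h ω ∂(Z.P r z)
      = ∫⁻ ω in B, ∫⁻ ω', h ω' ∂(Z.P t (Z.X t ω)) ∂(Z.P r z)) ?_ ?_ ?_ h hh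
  · intro c C hC
    simp only [lintegral_indicator_const hC]
    rw [lintegral_indicator_const (hle _ hC), Measure.restrict_apply (hle _ hC), inter_comm,
      Z.markov r t hrt z B C hB hC, lintegral_const_mul]
    exact (@Kernel.measurable_coe _ _ _ (Z.F (Ici t)) (Z.P t) C hC).comp (Z.measurable_X hrt)
  · intro f g _ hf hg ihf ihg
    simp only [Pi.add_apply]
    rw [lintegral_add_left (hf.mono hle le_rfl)]
    simp_rw [lintegral_add_left hf]
    rw [lintegral_add_left (Z.measurable_lintegral_P_X hrt hf), ihf, ihg]
  · intro f hf hmono ih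
    rw [lintegral_iSup (fun n => (hf n).mono hle le_rfl) hmono]
    simp_rw [lintegral_iSup hf hmono]
    rw [lintegral_iSup (fun n => Z.measurable_lintegral_P_X hrt (hf n))]
    · simp_rw [ih]
    · exact fun i j hij ω => lintegral_mono (hmono hij)

/-- The Markov property for products of nonnegative functions. -/
theorem lintegral_markov {r t : ℝ≥0} (hrt : r ≤ t) (z : S) {g h : Ω → ℝ≥0∞}
    (hg : Measurable[Z.F (Icc r t)] g) (hh : Measurable[Z.F (Ici t)] h) :
    ∫⁻ ω, g ω * h ω ∂(Z.P r z)
      = ∫⁻ ω, g ω * ∫⁻ ω', h ω' ∂(Z.P t (Z.X t ω)) ∂(Z.P r z) := by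
  have hle := Z.F_Ici_le hrt
  have hle' := Z.F_Icc_le le_rfl t (r := r)
  have hh' := hh.mono hle le_rfl
  have hk := Z.measurable_lintegral_P_X hrt hh
  refine @Measurable.ennreal_induction _ (Z.F (Icc r t))
    (fun g => ∫⁻ ω, g ω * h ω ∂(Z.P r z)
      = ∫⁻ ω, g ω * ∫⁻ ω', h ω' ∂(Z.P t (Z.X t ω)) ∂(Z.P r z)) ?_ ?_ ?_ g hg
  · intro c B hB
    have hind : ∀ k : Ω → ℝ≥0∞, (fun ω => B.indicator (fun _ => c) ω * k ω)
        = B.indicator (fun ω => c * k ω) := by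
      intro k
      ext ω
      by_cases hω : ω ∈ B <;> simp [hω]
    rw [hind, hind, lintegral_indicator (hle' _ hB), lintegral_indicator (hle' _ hB),
      lintegral_const_mul _ hh', lintegral_const_mul _ hk, Z.setLIntegral_markov hrt z hB hh]
  · intro f g _ hf hg ihf ihg
    simp only [Pi.add_apply, add_mul]
    rw [lintegral_add_left (f := fun ω => f ω * h ω) ((hf.mono hle' le_rfl).mul hh'),
      lintegral_add_left (f := fun ω => f ω * ∫⁻ ω', h ω' ∂(Z.P t (Z.X t ω)))
        ((hf.mono hle' le_rfl).mul hk), ihf, ihg]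
  · intro f hf hmono ih
    simp_rw [ENNReal.iSup_mul]
    rw [lintegral_iSup (f := fun n ω => f n ω * h ω)
        (fun n => ((hf n).mono hle' le_rfl).mul hh'),
      lintegral_iSup (f := fun n ω => f n ω * ∫⁻ ω', h ω' ∂(Z.P t (Z.X t ω)))
        (fun n => ((hf n).mono hle' le_rfl).mul hk)]
    · simp_rw [ih]
    · exact fun i j hij ω => mul_le_mul_left (hmono hij ω) _
    · exact fun i j hij ω => mul_le_mul_left (hmono hij ω) _

theorem lintegral_eq_lintegral_lintegral {r t : ℝ≥0} (hrt : r ≤ t) (z : S) {h : Ω → ℝ≥0∞}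
    (hh : Measurable[Z.F (Ici t)] h) :
    ∫⁻ ω, h ω ∂(Z.P r z) = ∫⁻ ω, ∫⁻ ω', h ω' ∂(Z.P t (Z.X t ω)) ∂(Z.P r z) := by
  simpa using Z.lintegral_markov hrt z (g := fun _ => 1) measurable_const hh

theorem law_dirac (r : ℝ≥0) (z : S) : Z.law r (Measure.dirac z) = Z.P r z :=
  @Measure.dirac_bind _ _ _ (Z.F (Ici r)) _ (@Kernel.measurable _ _ _ (Z.F (Ici r)) (Z.P r)) z

theorem law_apply (r : ℝ≥0) (μ : Measure S) {E : Set Ω} (hE : MeasurableSet[Z.F (Ici r)] E) :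
    Z.law r μ E = ∫⁻ y, Z.P r y E ∂μ :=
  @Measure.bind_apply _ _ _ (Z.F (Ici r)) μ (Z.P r) E hE
    (@Kernel.measurable _ _ _ (Z.F (Ici r)) (Z.P r)).aemeasurable

theorem ae_ae_of_ae_law {r : ℝ≥0} {μ : Measure S} {p : Ω → Prop} (h : ∀ᵐ ω ∂(Z.law r μ), p ω) :
    ∀ᵐ y ∂μ, ∀ᵐ ω ∂(Z.P r y), p ω :=
  @Measure.ae_ae_of_ae_bind _ _ _ (Z.F (Ici r)) μ (Z.P r) p
    (@Kernel.measurable _ _ _ (Z.F (Ici r)) (Z.P r)).aemeasurable h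

theorem ae_law_of_forall {r : ℝ≥0} {μ : Measure S} {E : Set Ω}
    (hE : MeasurableSet[Z.F (Ici r)] E) (h : ∀ᵐ y ∂μ, ∀ᵐ ω ∂(Z.P r y), ω ∈ E) :
    ∀ᵐ ω ∂(Z.law r μ), ω ∈ E := by
  have hE' : MeasurableSet[Z.F (Ici r)] Eᶜ := hE.compl
  rw [ae_iff]
  change Z.law r μ Eᶜ = 0
  rw [Z.law_apply r μ hE', lintegral_eq_zero_iff']
  · filter_upwards [h] with y hy using ae_iff.1 hy
  · exact (@Kernel.measurable_coe _ _ _ (Z.F (Ici r)) (Z.P r) _ hE').aemeasurable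

/-- A measurable relation that holds almost surely for every starting point holds almost surely for
every initial distribution. -/
theorem ae_law_of_forall_start {r : ℝ≥0} {μ : Measure S} {f g : Ω → ℝ≥0∞}
    (hf : HasVersion (Z.F (Ici r)) (Z.law r μ) f) (hg : HasVersion (Z.F (Ici r)) (Z.law r μ) g)
    {R : Set (ℝ≥0∞ × ℝ≥0∞)} (hR : MeasurableSet R)
    (h : ∀ y, ∀ᵐ ω ∂(Z.P r y), (f ω, g ω) ∈ R) : ∀ᵐ ω ∂(Z.law r μ), (f ω, g ω) ∈ R := by
  obtain ⟨f', hf1, hf2⟩ := hf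
  obtain ⟨g', hg1, hg2⟩ := hg
  have hm : MeasurableSet[Z.F (Ici r)] {ω | (f' ω, g' ω) ∈ R} := (hf1.prodMk hg1) hR
  have := Z.ae_law_of_forall (μ := μ) hm (by
    filter_upwards [Z.ae_ae_of_ae_law hf2, Z.ae_ae_of_ae_law hg2] with y h1 h2
    filter_upwards [h1, h2, h y] with ω a b c
    rwa [← a, ← b])
  filter_upwards [this, hf2, hg2] with ω a b c
  rw [b, c]
  exact a

/-- The distribution of `X_t` under `P_{r,z}`. -/
noncomputable def dist (r : ℝ≥0) (z : S) (t : ℝ≥0) : Measure S :=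
  @Measure.map _ _ (Z.F (Ici r)) _ (Z.X t) (Z.P r z)

theorem isProbabilityMeasure_dist {r t : ℝ≥0} (h : r ≤ t) (z : S) :
    IsProbabilityMeasure (Z.dist r z t) :=
  @Measure.isProbabilityMeasure_map _ _ (Z.F (Ici r)) _ (Z.P r z) _ _
    (Z.measurable_X h).aemeasurable

/-- By the Markov property, `P_{r,z}` and `P_{t,μ}` with `μ` the distribution of `X_t` agree on the
future of `t`. -/
theorem law_dist {r t : ℝ≥0} (h : r ≤ t) (z : S) :
    Z.law t (Z.dist r z t) = (Z.P r z).trim (Z.F_Ici_le h) := by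
  refine @Measure.ext _ (Z.F (Ici t)) _ _ fun C hC => ?_
  rw [Z.law_apply _ _ hC, trim_measurableSet_eq _ hC, dist,
    @lintegral_map _ _ (Z.F (Ici r)) _ _ _ _
      (@Kernel.measurable_coe _ _ _ (Z.F (Ici t)) (Z.P t) C hC) (Z.measurable_X h)]
  have := Z.markov r t h z univ C MeasurableSet.univ hC
  simpa using this.symm

theorem ae_of_ae_law_dist {r t : ℝ≥0} (h : r ≤ t) {z : S} {p : Ω → Prop}
    (hp : ∀ᵐ ω ∂(Z.law t (Z.dist r z t)), p ω) : ∀ᵐ ω ∂(Z.P r z), p ω := by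
  rw [Z.law_dist h] at hp
  exact ae_of_ae_trim _ hp

theorem hasVersion_of_law_dist {r t : ℝ≥0} (h : r ≤ t) {z : S} {m : MeasurableSpace Ω}
    {f : Ω → ℝ≥0∞} (hf : HasVersion m (Z.law t (Z.dist r z t)) f) :
    HasVersion m (Z.P r z) f := by
  obtain ⟨g, h1, h2⟩ := hf
  exact ⟨g, h1, Z.ae_of_ae_law_dist h h2⟩

end MarkovProcess

/-! ### Additive functionals -/

section Functionals

variable {S Ω : Type*} [TopologicalSpace S] [MeasurableSpace S] {Z : RightProcess S Ω}

namespace AdditiveFunctional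

variable (A B : AdditiveFunctional Z)

theorem hasVersion_law (s t : ℝ≥0) (μ : Measure S) [IsProbabilityMeasure μ] :
    HasVersion (Z.F (Icc s t)) (Z.law s μ) fun ω => A.meas ω (Icc s t) := by
  by_cases hst : s ≤ t
  · exact A.adapted s s t le_rfl hst μ inferInstance
  · simp only [Icc_eq_empty hst, measure_empty]
    exact HasVersion.of_measurable measurable_const

theorem hasVersion {r s : ℝ≥0} (hrs : r ≤ s) (t : ℝ≥0) (z : S) :
    HasVersion (Z.F (Icc s t)) (Z.P r z) fun ω => A.meas ω (Icc s t) := by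
  have := Z.isProbabilityMeasure_dist hrs z
  exact Z.hasVersion_of_law_dist hrs (A.hasVersion_law s t _)

theorem aemeasurable {r s : ℝ≥0} (hrs : r ≤ s) (t : ℝ≥0) (z : S) :
    AEMeasurable (fun ω => A.meas ω (Icc s t)) (Z.P r z) :=
  (A.hasVersion hrs t z).aemeasurable (Z.F_Icc_le hrs t)

theorem hasVersion_Ici_law (s : ℝ≥0) (μ : Measure S) [IsProbabilityMeasure μ] :
    HasVersion (Z.F (Ici s)) (Z.law s μ) fun ω => A.meas ω (Ici s) := by
  refine (HasVersion.iSup fun n : ℕ =>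
    (A.hasVersion_law s n μ).mono (Z.F_Icc_le le_rfl n)).congr (Eventually.of_forall fun ω => ?_)
  have hU : Ici s = ⋃ n : ℕ, Icc s (n : ℝ≥0) := by
    ext x
    simp only [mem_Ici, mem_iUnion, mem_Icc]
    exact ⟨fun h => (exists_nat_ge x).imp fun n hn => ⟨h, hn⟩, fun ⟨n, h⟩ => h.1⟩
  have hmono : Monotone fun n : ℕ => Icc s (n : ℝ≥0) :=
    fun i j hij => Icc_subset_Icc_right (by exact_mod_cast hij)
  rw [hU, hmono.measure_iUnion]

theorem aemeasurable_Ici (s : ℝ≥0) (z : S) :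
    AEMeasurable (fun ω => A.meas ω (Ici s)) (Z.P s z) := by
  have := A.hasVersion_Ici_law s (Measure.dirac z)
  rw [Z.law_dirac] at this
  exact this.aemeasurable le_rfl

variable {A B}

theorem IsContinuous.ae_law_lt_top (hA : A.IsContinuous) {s t : ℝ≥0} (hst : s ≤ t)
    (μ : Measure S) [IsProbabilityMeasure μ] :
    ∀ᵐ ω ∂(Z.law s μ), A.meas ω (Icc s t) < ∞ := by
  have hv := (A.hasVersion_law s t μ).mono (Z.F_Icc_le le_rfl t)
  exact Z.ae_law_of_forall_start hv hv (R := {p | p.1 < ∞})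
    (measurableSet_lt measurable_fst measurable_const)
    fun y => (hA s y).mono fun ω hω => (hω t hst).1

/-- An almost sure inequality between the masses of `[s,t]` when the process starts at time `s`
persists when the process starts earlier. -/
theorem ae_Icc_le_of_start {s t : ℝ≥0}
    (h : ∀ y, ∀ᵐ ω ∂(Z.P s y), A.meas ω (Icc s t) ≤ B.meas ω (Icc s t)) {r : ℝ≥0} (hrs : r ≤ s)
    (z : S) : ∀ᵐ ω ∂(Z.P r z), A.meas ω (Icc s t) ≤ B.meas ω (Icc s t) := by
  have := Z.isProbabilityMeasure_dist hrs z
  refine Z.ae_of_ae_law_dist hrs ?_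
  exact Z.ae_law_of_forall_start ((A.hasVersion_law s t _).mono (Z.F_Icc_le le_rfl t))
    ((B.hasVersion_law s t _).mono (Z.F_Icc_le le_rfl t)) (R := {p | p.1 ≤ p.2})
    (measurableSet_le measurable_fst measurable_snd) h

/-- If `A[s,t] ≤ B[s,t]` almost surely for all `s` and `t`, then almost surely `A ≤ B` as measures on
`[r,T]`. -/
theorem ae_restrict_le {r T : ℝ≥0} (z : S)
    (h : ∀ s t : ℝ≥0, s ≤ t → t ≤ T → ∀ y,
      ∀ᵐ ω ∂(Z.P s y), A.meas ω (Icc s t) ≤ B.meas ω (Icc s t))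
    (hB : ∀ᵐ ω ∂(Z.P r z), B.meas ω (Icc r T) < ∞) :
    ∀ᵐ ω ∂(Z.P r z), (A.meas ω).restrict (Icc r T) ≤ (B.meas ω).restrict (Icc r T) := by
  have hgrid : ∀ᵐ ω ∂(Z.P r z), ∀ n i j : ℕ,
      A.meas ω (Icc (r ⊔ dyadicPoint n i) (T ⊓ dyadicPoint n j))
        ≤ B.meas ω (Icc (r ⊔ dyadicPoint n i) (T ⊓ dyadicPoint n j)) := by
    refine ae_all_iff.2 fun n => ae_all_iff.2 fun i => ae_all_iff.2 fun j => ?_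
    by_cases hij : r ⊔ dyadicPoint n i ≤ T ⊓ dyadicPoint n j
    · exact ae_Icc_le_of_start (h _ _ hij inf_le_left) le_sup_left z
    · simp [Icc_eq_empty hij]
  filter_upwards [hgrid, hB] with ω h1 h2
  refine measure_le_of_Icc_le_of_Icc h2.ne fun a b hra hab hbT => ?_
  let I : ℕ → Set ℝ≥0 := fun n =>
    Icc (r ⊔ dyadicPoint n (dyadicIndex n a)) (T ⊓ dyadicCeil n b)
  have hsub : ∀ n, Icc a b ⊆ I n := fun n =>
    Icc_subset_Icc (sup_le hra (dyadicPoint_index_le n a)) (le_inf hbT (lt_dyadicCeil n b).le)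
  have hinter : ⋂ n, I n = Icc a b := by
    refine Subset.antisymm (fun x hx => ?_) (subset_iInter hsub)
    simp only [I, mem_iInter, mem_Icc, sup_le_iff, le_inf_iff] at hx
    exact ⟨le_of_tendsto' (tendsto_dyadicFloor a) fun n => (hx n).1.2,
      ge_of_tendsto' (tendsto_dyadicCeil b) fun n => (hx n).2.2⟩
  have hanti : Antitone I := fun i j hij =>
    Icc_subset_Icc (sup_le_sup_left (monotone_dyadicFloor a hij) _)
      (inf_le_inf_left _ (antitone_dyadicCeil b hij))
  have hlim : Tendsto (fun n => B.meas ω (I n)) atTop (𝓝 (B.meas ω (Icc a b))) := by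
    rw [← hinter]
    refine tendsto_measure_iInter_atTop (fun n => measurableSet_Icc.nullMeasurableSet) hanti
      ⟨0, ((measure_mono ?_).trans_lt h2).ne⟩
    exact Icc_subset_Icc le_sup_left inf_le_left
  exact ge_of_tendsto' hlim fun n => (measure_mono (hsub n)).trans (h1 n _ _)

end AdditiveFunctional

/-- The tail integrals of `h(v)` with respect to a continuous additive functional are adapted. -/
theorem IsProgressive.hasVersion_lintegral {L : AdditiveFunctional Z} (hL : L.IsContinuous)
    {T : ℝ≥0} {v : ℝ≥0 → S → ℝ≥0} (hv : IsProgressive Z T v) {h : ℝ≥0 → ℝ≥0∞} (hh : Measurable h)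
    {s t : ℝ≥0} (hst : s ≤ t) (htT : t ≤ T) (μ : Measure S) [IsProbabilityMeasure μ] :
    HasVersion (Z.F (Icc s t)) (Z.law s μ)
      fun ω => ∫⁻ u in Icc s t, h (v u (Z.X u ω)) ∂(L.meas ω) := by
  obtain ⟨g, hg1, hg2⟩ := hv s t hst htT μ inferInstance
  have := @_root_.hasVersion_lintegral Ω (Z.F (Ici s)) (Z.F (Icc s t)) (Z.law s μ) L.meas s t
    (hL.ae_law_lt_top hst μ)
    (fun a b hsa hab hbt => HasVersion.mono (L.adapted s a b hsa hab μ inferInstance)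
      (Z.F_mono _ _ (Icc_subset_Icc hsa hbt)))
    (fun p => h (g p)) (hh.comp hg1)
  refine this.congr ?_
  filter_upwards [hg2] with ω hω
  exact setLIntegral_congr_fun measurableSet_Icc fun u hu => by simp only [hω u hu]

end Functionals

/-! ### Dyadic limits along a kernel -/

section DyadicLimit

variable {Ω : Type*} [MeasurableSpace Ω] {P : Measure Ω} [IsFiniteMeasure P]
  {κ : Kernel Ω ℝ≥0} [IsFiniteKernel κ]

theorem aemeasurable_compProd_fst {m : Ω → ℝ≥0∞} (hm : AEMeasurable m P) :
    AEMeasurable (fun p : Ω × ℝ≥0 => m p.1) (P ⊗ₘ κ) := by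
  obtain ⟨g, hg, hmg⟩ := hm
  exact ⟨fun p => g p.1, hg.comp measurable_fst, ae_compProd_of_ae_fst hmg⟩

theorem lintegral_compProd_of_aemeasurable {f : Ω × ℝ≥0 → ℝ≥0∞} (hf : AEMeasurable f (P ⊗ₘ κ)) :
    AEMeasurable (fun ω => ∫⁻ s, f (ω, s) ∂(κ ω)) P ∧
    ∫⁻ p, f p ∂(P ⊗ₘ κ) = ∫⁻ ω, ∫⁻ s, f (ω, s) ∂(κ ω) ∂P := by
  obtain ⟨g, hg, hfg⟩ := hf
  have h : (fun ω => ∫⁻ s, f (ω, s) ∂(κ ω)) =ᵐ[P] fun ω => ∫⁻ s, g (ω, s) ∂(κ ω) := by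
    filter_upwards [Measure.ae_ae_of_ae_compProd hfg] with ω hω using lintegral_congr_ae hω
  refine ⟨⟨_, Measurable.lintegral_kernel_prod_right (f := fun ω s => g (ω, s)) hg, h⟩, ?_⟩
  rw [lintegral_congr_ae hfg, Measure.lintegral_compProd hg, lintegral_congr_ae h]

theorem lintegral_compProd_indicator {m : Ω → ℝ≥0∞} (hm : AEMeasurable m P) {I : Set ℝ≥0}
    (hI : MeasurableSet I) :
    AEMeasurable (fun p : Ω × ℝ≥0 => I.indicator (fun _ => m p.1) p.2) (P ⊗ₘ κ) ∧
    ∫⁻ p, I.indicator (fun _ => m p.1) p.2 ∂(P ⊗ₘ κ) = ∫⁻ ω, m ω * κ ω I ∂P := by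
  have hae : AEMeasurable (fun p : Ω × ℝ≥0 => I.indicator (fun _ => m p.1) p.2) (P ⊗ₘ κ) := by
    have : (fun p : Ω × ℝ≥0 => I.indicator (fun _ => m p.1) p.2)
        = (Prod.snd ⁻¹' I).indicator fun p => m p.1 := by
      ext p; rfl
    rw [this]
    exact (aemeasurable_compProd_fst hm).indicator (measurable_snd hI)
  refine ⟨hae, ?_⟩
  rw [(lintegral_compProd_of_aemeasurable hae).2]
  exact lintegral_congr fun ω => lintegral_indicator_const hI (m ω)

theorem ae_compProd_le {r : ℝ≥0} (hr : ∀ᵐ ω ∂P, κ ω (Iio r) = 0) :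
    ∀ᵐ p ∂(P ⊗ₘ κ), r ≤ p.2 := by
  refine (Measure.ae_compProd_iff (p := fun p : Ω × ℝ≥0 => r ≤ p.2)
    (measurableSet_le measurable_const measurable_snd)).2 ?_
  filter_upwards [hr] with ω hω
  rw [ae_iff]
  simpa [Iio] using hω

theorem lintegral_compProd_dyadicCeil {r : ℝ≥0} (hr : ∀ᵐ ω ∂P, κ ω (Iio r) = 0)
    {G : ℝ≥0 → ℝ≥0 → Ω → ℝ≥0∞} {m : ℝ≥0 → Ω → ℝ≥0∞}
    (hG : ∀ a t, r ≤ a → a < t →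
      AEMeasurable (fun p : Ω × ℝ≥0 => (Ico a t).indicator (fun s => G t s p.1) p.2) (P ⊗ₘ κ) ∧
      ∫⁻ p, (Ico a t).indicator (fun s => G t s p.1) p.2 ∂(P ⊗ₘ κ)
        = ∫⁻ ω, m t ω * κ ω (Ico a t) ∂P) (n : ℕ) :
    AEMeasurable (fun p : Ω × ℝ≥0 => G (dyadicCeil n p.2) p.2 p.1) (P ⊗ₘ κ) ∧
    ∫⁻ p, G (dyadicCeil n p.2) p.2 p.1 ∂(P ⊗ₘ κ)
      = ∑' i, ∫⁻ ω, m (dyadicPoint n (i + 1)) ω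
          * κ ω (Ico (r ⊔ dyadicPoint n i) (dyadicPoint n (i + 1))) ∂P := by
  let D : ℕ → Set ℝ≥0 := fun i => Ico (r ⊔ dyadicPoint n i) (dyadicPoint n (i + 1))
  let f : ℕ → Ω × ℝ≥0 → ℝ≥0∞ := fun i p =>
    (D i).indicator (fun s => G (dyadicPoint n (i + 1)) s p.1) p.2
  have hf : ∀ i, AEMeasurable (f i) (P ⊗ₘ κ) ∧
      ∫⁻ p, f i p ∂(P ⊗ₘ κ) = ∫⁻ ω, m (dyadicPoint n (i + 1)) ω * κ ω (D i) ∂P := by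
    intro i
    by_cases h : r ⊔ dyadicPoint n i < dyadicPoint n (i + 1)
    · exact hG _ _ le_sup_left h
    · simp [f, D, Ico_eq_empty h]
  have hsum : (fun p : Ω × ℝ≥0 => G (dyadicCeil n p.2) p.2 p.1) =ᵐ[P ⊗ₘ κ]
      fun p => ∑' i, f i p := by
    filter_upwards [ae_compProd_le hr] with p hp
    rw [tsum_eq_single (dyadicIndex n p.2)]
    · have : p.2 ∈ D (dyadicIndex n p.2) :=
        ⟨sup_le hp (dyadicPoint_index_le n p.2), lt_dyadicCeil n p.2⟩
      simp [f, this, dyadicCeil]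
    · intro i hi
      have : p.2 ∉ D i := fun h =>
        hi ((dyadicIndex_eq_iff n i p.2).2 ⟨le_sup_right.trans h.1, h.2⟩).symm
      simp [f, this]
  refine ⟨(AEMeasurable.tsum fun i => (hf i).1).congr hsum.symm, ?_⟩
  rw [lintegral_congr_ae hsum, lintegral_tsum fun i => (hf i).1]
  exact tsum_congr fun i => (hf i).2

/-- If `G t` may replace `m t` under the integral over `[a,t)` for every `t`, then this
persists in the limit where `t` decreases to the integration variable. -/
theorem lintegral_compProd_iSup_dyadicCeil {r : ℝ≥0} (hr : ∀ᵐ ω ∂P, κ ω (Iio r) = 0)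
    {G : ℝ≥0 → ℝ≥0 → Ω → ℝ≥0∞} {m : ℝ≥0 → Ω → ℝ≥0∞}
    (hm : ∀ t, r ≤ t → AEMeasurable (m t) P)
    (hG : ∀ a t, r ≤ a → a < t →
      AEMeasurable (fun p : Ω × ℝ≥0 => (Ico a t).indicator (fun s => G t s p.1) p.2) (P ⊗ₘ κ) ∧
      ∫⁻ p, (Ico a t).indicator (fun s => G t s p.1) p.2 ∂(P ⊗ₘ κ)
        = ∫⁻ ω, m t ω * κ ω (Ico a t) ∂P)
    (hGanti : ∀ s ω, Antitone fun t => G t s ω) (hmanti : ∀ ω, Antitone fun t => m t ω) :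
    AEMeasurable (fun p : Ω × ℝ≥0 => ⨆ n, G (dyadicCeil n p.2) p.2 p.1) (P ⊗ₘ κ) ∧
    AEMeasurable (fun p : Ω × ℝ≥0 => ⨆ n, m (dyadicCeil n p.2) p.1) (P ⊗ₘ κ) ∧
    ∫⁻ p, ⨆ n, G (dyadicCeil n p.2) p.2 p.1 ∂(P ⊗ₘ κ)
      = ∫⁻ p, ⨆ n, m (dyadicCeil n p.2) p.1 ∂(P ⊗ₘ κ) := by
  have h1 := lintegral_compProd_dyadicCeil hr hG
  have h2 := lintegral_compProd_dyadicCeil (G := fun t _ ω => m t ω) (m := m) hr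
    fun a t hra hat => lintegral_compProd_indicator (hm t (hra.trans hat.le)) measurableSet_Ico
  refine ⟨AEMeasurable.iSup fun n => (h1 n).1, AEMeasurable.iSup fun n => (h2 n).1, ?_⟩
  rw [lintegral_iSup' (fun n => (h1 n).1), lintegral_iSup' (fun n => (h2 n).1)]
  · simp_rw [(h1 _).2, (h2 _).2]
  · exact Eventually.of_forall fun p i j hij => hmanti _ (antitone_dyadicCeil p.2 hij)
  · exact Eventually.of_forall fun p i j hij => hGanti _ _ (antitone_dyadicCeil p.2 hij)

end DyadicLimit

/-! ### Projecting the future along an adapted random measure -/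

section Projection

variable {S Ω : Type*} [TopologicalSpace S] [MeasurableSpace S] {Z : RightProcess S Ω}
  {r : ℝ≥0} {z : S}

/-- A kernel `κ` from `Ω` to the time axis is an adapted clock under `P_{r,z}` if it charges only
times after `r` and the mass of `[r,t)` is, up to null sets, observable during `[r,t]`. -/
structure IsAdaptedClock (Z : RightProcess S Ω) (r : ℝ≥0) (z : S)
    (κ : @Kernel Ω ℝ≥0 (Z.F (Ici r)) _) : Prop where
  isFiniteKernel : @IsFiniteKernel Ω ℝ≥0 (Z.F (Ici r)) _ κ
  before : ∀ᵐ ω ∂(Z.P r z), κ ω (Iio r) = 0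
  adapted : ∀ t, r ≤ t → HasVersion (Z.F (Icc r t)) (Z.P r z) fun ω => κ ω (Iio t)

namespace IsAdaptedClock

variable {κ : @Kernel Ω ℝ≥0 (Z.F (Ici r)) _}

theorem hasVersion_Ico (hκ : IsAdaptedClock Z r z κ) {a t : ℝ≥0} (ht : r ≤ t) (hat : a ≤ t) :
    HasVersion (Z.F (Icc r t)) (Z.P r z) fun ω => κ ω (Ico a t) := by
  have := hκ.isFiniteKernel
  rcases le_or_gt r a with hra | hra
  · refine ((hκ.adapted t ht).sub ((hκ.adapted a hra).mono
      (Z.F_mono _ _ (Icc_subset_Icc_right hat)))).congr (Eventually.of_forall fun ω => ?_)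
    rw [← measure_sdiff (Iio_subset_Iio hat) measurableSet_Iio.nullMeasurableSet
      (measure_ne_top _ _)]
    congr 1
    ext s
    simp only [mem_Ico, Set.mem_sdiff, mem_Iio, not_lt]
    tauto
  · refine (hκ.adapted t ht).congr ?_
    filter_upwards [hκ.before] with ω hω
    refine le_antisymm (measure_mono Ico_subset_Iio_self) ?_
    calc κ ω (Iio t) ≤ κ ω (Iio r ∪ Ico a t) := measure_mono fun s hs => by
          rcases lt_or_ge s r with h | h
          · exact Or.inl h
          · exact Or.inr ⟨hra.le.trans h, hs⟩
      _ ≤ κ ω (Iio r) + κ ω (Ico a t) := measure_union_le _ _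
      _ = κ ω (Ico a t) := by rw [hω, zero_add]

theorem lintegral_mul_Ico (hκ : IsAdaptedClock Z r z κ) {a t : ℝ≥0} (ht : r ≤ t) (hat : a ≤ t)
    {h : Ω → ℝ≥0∞} (hh : Measurable[Z.F (Ici t)] h) :
    ∫⁻ ω, (∫⁻ ω', h ω' ∂(Z.P t (Z.X t ω))) * κ ω (Ico a t) ∂(Z.P r z)
      = ∫⁻ ω, h ω * κ ω (Ico a t) ∂(Z.P r z) := by
  obtain ⟨g, hg1, hg2⟩ := hκ.hasVersion_Ico ht hat
  have h1 := Z.lintegral_markov ht z hg1 hh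
  have h2 : ∀ k : Ω → ℝ≥0∞, ∫⁻ ω, k ω * κ ω (Ico a t) ∂(Z.P r z)
      = ∫⁻ ω, g ω * k ω ∂(Z.P r z) := fun k => by
    refine lintegral_congr_ae ?_
    filter_upwards [hg2] with ω hω
    rw [hω, mul_comm]
  rw [h2, h2, h1]

theorem projection_bounded (hκ : IsAdaptedClock Z r z κ) {f : S → ℝ≥0} (hf : Measurable f)
    {c : ℝ≥0} (hc : ∀ y, f y ≤ c) {a t : ℝ≥0} (hra : r ≤ a) :
    AEMeasurable (fun p : Ω × ℝ≥0 => (Ico a t).indicator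
      (fun s => ∫⁻ ω', (f (Z.X t ω') : ℝ≥0∞) ∂(Z.P s (Z.X s p.1))) p.2) (Z.P r z ⊗ₘ κ) ∧
    ∫⁻ p, (Ico a t).indicator
      (fun s => ∫⁻ ω', (f (Z.X t ω') : ℝ≥0∞) ∂(Z.P s (Z.X s p.1))) p.2 ∂(Z.P r z ⊗ₘ κ)
      = ∫⁻ ω, (f (Z.X t ω) : ℝ≥0∞) * κ ω (Ico a t) ∂(Z.P r z) := by
  have := hκ.isFiniteKernel
  rcases le_or_gt t a with hta | hat
  · simp [Ico_eq_empty (not_lt.2 hta)]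
  have hfm : ∀ s ≤ t, Measurable[Z.F (Ici s)] fun ω => (f (Z.X t ω) : ℝ≥0∞) := fun s hs =>
    measurable_coe_nnreal_ennreal.comp (hf.comp (Z.measurable_X hs))
  refine @lintegral_compProd_of_rightContinuous Ω (Z.F (Ici r)) (Z.P r z) _ κ _ a t
    (fun s ω => ∫⁻ ω', (f (Z.X t ω') : ℝ≥0∞) ∂(Z.P s (Z.X s ω))) (fun ω => (f (Z.X t ω) : ℝ≥0∞))
    c ?_ ?_ (hfm r (hra.trans hat.le)) (fun ω => by exact_mod_cast hc _) ?_ ?_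
  · intro s hs
    exact Z.measurable_lintegral_P_X (hra.trans hs.1) (hfm s hs.2.le)
  · intro s hs ω
    calc ∫⁻ ω', (f (Z.X t ω') : ℝ≥0∞) ∂(Z.P s (Z.X s ω))
        ≤ ∫⁻ _, (c : ℝ≥0∞) ∂(Z.P s (Z.X s ω)) :=
          lintegral_mono fun ω' => ENNReal.coe_le_coe.2 (hc _)
      _ = c := by simp
  · have := Z.right r t (hra.trans_lt hat) f hf (Measure.dirac z) inferInstance
    rw [Z.law_dirac] at this
    filter_upwards [this] with ω hω s hs
    exact hω s ⟨hra.trans hs.1, hs.2⟩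
  · intro s' s hs's hs
    exact hκ.lintegral_mul_Ico (hra.trans hs.1) hs's.le (hfm s hs.2.le)

theorem projection_X (hκ : IsAdaptedClock Z r z κ) {f : S → ℝ≥0∞} (hf : Measurable f)
    {a t : ℝ≥0} (hra : r ≤ a) :
    AEMeasurable (fun p : Ω × ℝ≥0 => (Ico a t).indicator
      (fun s => ∫⁻ ω', f (Z.X t ω') ∂(Z.P s (Z.X s p.1))) p.2) (Z.P r z ⊗ₘ κ) ∧
    ∫⁻ p, (Ico a t).indicator
      (fun s => ∫⁻ ω', f (Z.X t ω') ∂(Z.P s (Z.X s p.1))) p.2 ∂(Z.P r z ⊗ₘ κ)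
      = ∫⁻ ω, f (Z.X t ω) * κ ω (Ico a t) ∂(Z.P r z) := by
  have := hκ.isFiniteKernel
  rcases le_or_gt t a with hta | hat
  · simp [Ico_eq_empty (not_lt.2 hta)]
  let g : ℕ → S → ℝ≥0 := fun n y => (min (f y) n).toNNReal
  have hgm : ∀ n, Measurable (g n) := fun n => (hf.min measurable_const).ennreal_toNNReal
  have hgc : ∀ n y, (g n y : ℝ≥0∞) = min (f y) n := fun n y =>
    ENNReal.coe_toNNReal (ne_top_of_le_ne_top (ENNReal.natCast_ne_top n) (min_le_right _ _))
  have hgn : ∀ n y, g n y ≤ (n : ℝ≥0) := fun n y => by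
    have := hgc n y
    have h2 : (g n y : ℝ≥0∞) ≤ ((n : ℝ≥0) : ℝ≥0∞) := by
      rw [this]; exact (min_le_right _ _).trans (by simp)
    exact_mod_cast h2
  have hsup : ∀ y, f y = ⨆ n, (g n y : ℝ≥0∞) := by
    intro y
    simp_rw [hgc]
    rw [← inf_iSup_eq, ENNReal.iSup_natCast, inf_top_eq]
  have hmono : ∀ y, Monotone fun n => (g n y : ℝ≥0∞) := by
    intro y i j hij
    simp only [hgc]
    exact min_le_min_left _ (by exact_mod_cast hij)
  have key := fun n => hκ.projection_bounded (hgm n) (hgn n) (t := t) hra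
  have hXm : ∀ n, ∀ s ≤ t, Measurable[Z.F (Ici s)] fun ω => (g n (Z.X t ω) : ℝ≥0∞) :=
    fun n s hs => measurable_coe_nnreal_ennreal.comp ((hgm n).comp (Z.measurable_X hs))
  have hfun : (fun p : Ω × ℝ≥0 => (Ico a t).indicator
      (fun s => ∫⁻ ω', f (Z.X t ω') ∂(Z.P s (Z.X s p.1))) p.2)
      = fun p => ⨆ n, (Ico a t).indicator
        (fun s => ∫⁻ ω', (g n (Z.X t ω') : ℝ≥0∞) ∂(Z.P s (Z.X s p.1))) p.2 := by
    ext p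
    by_cases hs : p.2 ∈ Ico a t
    · simp only [hs, indicator_of_mem, hsup]
      exact lintegral_iSup (fun n => hXm n _ hs.2.le) fun i j hij ω => hmono _ hij
    · simp [hs]
  rw [hfun]
  refine ⟨AEMeasurable.iSup fun n => (key n).1, ?_⟩
  rw [lintegral_iSup' (fun n => (key n).1)]
  · simp_rw [(key _).2, hsup, ENNReal.iSup_mul]
    refine (lintegral_iSup (f := fun n ω => (g n (Z.X t ω) : ℝ≥0∞) * κ ω (Ico a t))
      (fun n => (hXm n r (hra.trans hat.le)).mul (Kernel.measurable_coe κ measurableSet_Ico))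
      fun i j hij ω => mul_le_mul_left (hmono _ hij) _).symm
  · refine Eventually.of_forall fun p i j hij => ?_
    by_cases hs : p.2 ∈ Ico a t
    · simp only [hs, indicator_of_mem]
      exact lintegral_mono fun ω => hmono _ hij
    · simp [hs]

/-- The functions `s ↦ E_{s,X_s}[η]`, with `η` depending on the future of `t`, may replace `η` under
the integral over `[a,t)` with respect to an adapted clock. -/
theorem projection (hκ : IsAdaptedClock Z r z κ) {a t : ℝ≥0} (hra : r ≤ a) (hat : a ≤ t)
    {η : Ω → ℝ≥0∞} (hη : HasVersion (Z.F (Ici t)) (Z.law t (Z.dist r z t)) η) :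
    AEMeasurable (fun p : Ω × ℝ≥0 => (Ico a t).indicator
      (fun s => ∫⁻ ω', η ω' ∂(Z.P s (Z.X s p.1))) p.2) (Z.P r z ⊗ₘ κ) ∧
    ∫⁻ p, (Ico a t).indicator
      (fun s => ∫⁻ ω', η ω' ∂(Z.P s (Z.X s p.1))) p.2 ∂(Z.P r z ⊗ₘ κ)
      = ∫⁻ ω, η ω * κ ω (Ico a t) ∂(Z.P r z) := by
  have := hκ.isFiniteKernel
  have hrt := hra.trans hat
  obtain ⟨g, hg, hηg⟩ := hη
  obtain ⟨N, hN, hNm, hN0⟩ :=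
    @exists_measurable_superset_of_null _ (Z.F (Ici t)) _ _ (ae_iff.1 hηg)
  have hind : Measurable[Z.F (Ici t)] (N.indicator fun _ => (1 : ℝ≥0∞)) :=
    measurable_const.indicator hNm
  have hfuture : ∀ h : Ω → ℝ≥0∞, Measurable[Z.F (Ici t)] h → ∀ s ≤ t, ∀ y,
      ∫⁻ ω, h ω ∂(Z.P s y) = ∫⁻ ω, ∫⁻ ω', h ω' ∂(Z.P t (Z.X t ω)) ∂(Z.P s y) :=
    fun h hh s hs y => Z.lintegral_eq_lintegral_lintegral hs y hh
  have hNr : Z.P r z N = 0 := by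
    rw [Z.law_dist hrt] at hN0
    rwa [trim_measurableSet_eq _ hNm] at hN0
  -- The exceptional set `N` is null under `P_{s,X_s}` for almost all `s` with respect to the clock.
  have hNs : ∀ᵐ p ∂(Z.P r z ⊗ₘ κ), p.2 ∈ Ico a t → Z.P p.2 (Z.X p.2 p.1) N = 0 := by
    obtain ⟨h1, h2⟩ := hκ.projection_X (Z.measurable_lintegral_P hind) (t := t) hra
    rw [hκ.lintegral_mul_Ico hrt hat hind] at h2
    have h3 : ∫⁻ ω, N.indicator (fun _ => (1 : ℝ≥0∞)) ω * κ ω (Ico a t) ∂(Z.P r z) = 0 := by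
      rw [lintegral_eq_zero_iff' ]
      · filter_upwards [measure_eq_zero_iff_ae_notMem.1 hNr] with ω hω
        simp [hω]
      · exact ((hind.mono (Z.F_Ici_le hrt) le_rfl).mul
          (Kernel.measurable_coe κ measurableSet_Ico)).aemeasurable
    rw [h3, lintegral_eq_zero_iff' h1] at h2
    filter_upwards [h2] with p hp hs
    simp only [hs, indicator_of_mem, Pi.zero_apply] at hp
    rw [← hfuture _ hind _ hs.2.le, lintegral_indicator_const (Z.F_Ici_le hs.2.le _ hNm)] at hp
    simpa using hp
  obtain ⟨h1, h2⟩ := hκ.projection_X (Z.measurable_lintegral_P hg) (t := t) hra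
  have hcongr : (fun p : Ω × ℝ≥0 => (Ico a t).indicator
      (fun s => ∫⁻ ω', η ω' ∂(Z.P s (Z.X s p.1))) p.2) =ᵐ[Z.P r z ⊗ₘ κ] fun p =>
      (Ico a t).indicator
        (fun s => ∫⁻ ω, ∫⁻ ω', g ω' ∂(Z.P t (Z.X t ω)) ∂(Z.P s (Z.X s p.1))) p.2 := by
    filter_upwards [hNs] with p hp
    by_cases hs : p.2 ∈ Ico a t
    · simp only [hs, indicator_of_mem]
      rw [← hfuture _ hg _ hs.2.le]
      refine lintegral_congr_ae ?_
      filter_upwards [measure_eq_zero_iff_ae_notMem.1 (hp hs)] with ω hω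
      by_contra hc
      exact hω (hN hc)
    · simp [hs]
  refine ⟨h1.congr hcongr.symm, ?_⟩
  rw [lintegral_congr_ae hcongr, h2, hκ.lintegral_mul_Ico hrt hat hg]
  refine lintegral_congr_ae ?_
  filter_upwards [measure_eq_zero_iff_ae_notMem.1 hNr] with ω hω
  have : η ω = g ω := by
    by_contra hc
    exact hω (hN hc)
  rw [this]

/-- For an adapted random measure `M`, the conditional expectation of `M (s,T]` may replace
`M (s,T]` under the integral with respect to an adapted clock. -/
theorem projection_tail (hκ : IsAdaptedClock Z r z κ) {M : Ω → Measure ℝ≥0} {T : ℝ≥0}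
    (hM : ∀ t ≤ T, ∀ μ : Measure S, IsProbabilityMeasure μ →
      HasVersion (Z.F (Ici t)) (Z.law t μ) fun ω => M ω (Icc t T)) :
    AEMeasurable (fun p : Ω × ℝ≥0 => ∫⁻ ω', M ω' (Ioc p.2 T) ∂(Z.P p.2 (Z.X p.2 p.1)))
      (Z.P r z ⊗ₘ κ) ∧
    AEMeasurable (fun p : Ω × ℝ≥0 => M p.1 (Ioc p.2 T)) (Z.P r z ⊗ₘ κ) ∧
    ∫⁻ p, ∫⁻ ω', M ω' (Ioc p.2 T) ∂(Z.P p.2 (Z.X p.2 p.1)) ∂(Z.P r z ⊗ₘ κ)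
      = ∫⁻ p, M p.1 (Ioc p.2 T) ∂(Z.P r z ⊗ₘ κ) := by
  have := hκ.isFiniteKernel
  have hM' : ∀ s t : ℝ≥0, s ≤ t → ∀ y, AEMeasurable (fun ω => M ω (Icc t T)) (Z.P s y) := by
    intro s t hst y
    by_cases htT : t ≤ T
    · have := Z.isProbabilityMeasure_dist hst y
      exact (Z.hasVersion_of_law_dist hst (hM t htT _ inferInstance)).aemeasurable
        (Z.F_Ici_le hst)
    · simp [Icc_eq_empty htT]
  have key := @lintegral_compProd_iSup_dyadicCeil Ω (Z.F (Ici r)) (Z.P r z) _ κ _ r hκ.before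
    (fun t s ω => ∫⁻ ω', M ω' (Icc t T) ∂(Z.P s (Z.X s ω))) (fun t ω => M ω (Icc t T))
    (fun t hrt => hM' r t hrt z) ?_
    (fun s ω t t' htt' => lintegral_mono fun ω' => measure_mono (Icc_subset_Icc_left htt'))
    (fun ω t t' htt' => measure_mono (Icc_subset_Icc_left htt'))
  · have h1 : ∀ p : Ω × ℝ≥0,
        ⨆ n, ∫⁻ ω', M ω' (Icc (dyadicCeil n p.2) T) ∂(Z.P p.2 (Z.X p.2 p.1))
        = ∫⁻ ω', M ω' (Ioc p.2 T) ∂(Z.P p.2 (Z.X p.2 p.1)) := by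
      intro p
      rw [← lintegral_iSup' (fun n => hM' _ _ (lt_dyadicCeil n p.2).le _)]
      · simp_rw [iSup_measure_Icc_dyadicCeil]
      · exact Eventually.of_forall fun ω i j hij =>
          measure_mono (Icc_subset_Icc_left (antitone_dyadicCeil p.2 hij))
    simp_rw [h1, iSup_measure_Icc_dyadicCeil] at key
    exact key
  · intro a t hra hat
    by_cases htT : t ≤ T
    · have := Z.isProbabilityMeasure_dist (hra.trans hat.le) z
      exact hκ.projection hra hat.le (hM t htT _ inferInstance)
    · simp [Icc_eq_empty htT]

end IsAdaptedClock

end Projection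

/-! ### Potentials of functionals in the class `𝒜` -/

section Classes

variable {S Ω : Type*} [TopologicalSpace S] [MeasurableSpace S] {Z : RightProcess S Ω}
  {r : ℝ≥0} {z : S} {κ : @Kernel Ω ℝ≥0 (Z.F (Ici r)) _}

namespace AdditiveFunctional

variable {A : AdditiveFunctional Z}

theorem MemClass1.projection (hA : A.MemClass1) (hκ : IsAdaptedClock Z r z κ)
    (hatom : ∀ᵐ ω ∂(Z.P r z), ∀ s, κ ω {s} = 0) :
    AEMeasurable (fun p : Ω × ℝ≥0 => ∫⁻ ω', A.meas ω' (Ici p.2) ∂(Z.P p.2 (Z.X p.2 p.1)))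
      (Z.P r z ⊗ₘ κ) ∧
    AEMeasurable (fun p : Ω × ℝ≥0 => A.meas p.1 (Ici p.2)) (Z.P r z ⊗ₘ κ) ∧
    ∫⁻ p, ∫⁻ ω', A.meas ω' (Ici p.2) ∂(Z.P p.2 (Z.X p.2 p.1)) ∂(Z.P r z ⊗ₘ κ)
      = ∫⁻ p, A.meas p.1 (Ici p.2) ∂(Z.P r z ⊗ₘ κ) := by
  have := hκ.isFiniteKernel
  obtain ⟨τ, f, hf, -, hAf⟩ := hA
  have hAI : ∀ ω s, A.meas ω (Ici s)
      = ∑ t ∈ τ, (Ici s).indicator (fun t => (f t (Z.X t ω) : ℝ≥0∞)) t := by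
    intro ω s
    rw [hAf, Measure.finsetSum_apply]
    refine Finset.sum_congr rfl fun t _ => ?_
    rw [Measure.smul_apply, Measure.dirac_apply' _ measurableSet_Ici]
    by_cases ht : t ∈ Ici s
    · simp [ht]
    · simp [ht]
  have hτ : ∀ᵐ p ∂(Z.P r z ⊗ₘ κ), p.2 ∈ ((τ : Set ℝ≥0))ᶜ := by
    refine (@Measure.ae_compProd_iff _ _ (Z.F (Ici r)) _ _ _ _ _
      (fun p : Ω × ℝ≥0 => p.2 ∈ ((τ : Set ℝ≥0))ᶜ)
      (measurable_snd τ.measurableSet.compl)).2 ?_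
    filter_upwards [hatom] with ω hω
    have h0 : κ ω (τ : Set ℝ≥0) = 0 := by
      rw [← biUnion_of_singleton (τ : Set ℝ≥0), measure_biUnion_null_iff τ.countable_toSet]
      exact fun s _ => hω s
    exact measure_eq_zero_iff_ae_notMem.1 h0
  have hr := @ae_compProd_le Ω (Z.F (Ici r)) (Z.P r z) _ κ _ r hκ.before
  have hIco : ∀ s, r ≤ s → s ∉ τ → ∀ t ∈ τ, (t ∈ Ici s ↔ s ∈ Ico r t) := by
    intro s hrs hs t ht
    constructor
    · intro h
      exact ⟨hrs, lt_of_le_of_ne h fun h' => hs (h' ▸ ht)⟩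
    · intro h
      exact h.2.le
  have e1 : (fun p : Ω × ℝ≥0 => ∫⁻ ω', A.meas ω' (Ici p.2) ∂(Z.P p.2 (Z.X p.2 p.1)))
      =ᵐ[Z.P r z ⊗ₘ κ] fun p => ∑ t ∈ τ, (Ico r t).indicator
        (fun s => ∫⁻ ω', (f t (Z.X t ω') : ℝ≥0∞) ∂(Z.P s (Z.X s p.1))) p.2 := by
    filter_upwards [hτ, hr] with p hp1 hp2
    simp_rw [hAI]
    rw [lintegral_finsetSum]
    · refine Finset.sum_congr rfl fun t ht => ?_
      by_cases h : t ∈ Ici p.2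
      · simp [h, (hIco _ hp2 (by simpa using hp1) t ht).1 h]
      · simp [h, mt (hIco _ hp2 (by simpa using hp1) t ht).2 h]
    · intro t ht
      by_cases h : t ∈ Ici p.2
      · simp only [h, indicator_of_mem]
        exact measurable_coe_nnreal_ennreal.comp ((hf t ht).comp (Z.measurable_X h))
      · simp [h]
  have e2 : (fun p : Ω × ℝ≥0 => A.meas p.1 (Ici p.2)) =ᵐ[Z.P r z ⊗ₘ κ] fun p =>
      ∑ t ∈ τ, (Ico r t).indicator (fun _ => (f t (Z.X t p.1) : ℝ≥0∞)) p.2 := by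
    filter_upwards [hτ, hr] with p hp1 hp2
    rw [hAI]
    refine Finset.sum_congr rfl fun t ht => ?_
    by_cases h : t ∈ Ici p.2
    · simp [h, (hIco _ hp2 (by simpa using hp1) t ht).1 h]
    · simp [h, mt (hIco _ hp2 (by simpa using hp1) t ht).2 h]
  have k1 := fun t (ht : t ∈ τ) => hκ.projection_X (t := t) (a := r)
    (f := fun y => (f t y : ℝ≥0∞)) (measurable_coe_nnreal_ennreal.comp (hf t ht)) le_rfl
  have k2 : ∀ t ∈ τ,
      AEMeasurable (fun p : Ω × ℝ≥0 => (Ico r t).indicator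
        (fun _ => (f t (Z.X t p.1) : ℝ≥0∞)) p.2) (Z.P r z ⊗ₘ κ) ∧
      ∫⁻ p, (Ico r t).indicator (fun _ => (f t (Z.X t p.1) : ℝ≥0∞)) p.2 ∂(Z.P r z ⊗ₘ κ)
        = ∫⁻ ω, (f t (Z.X t ω) : ℝ≥0∞) * κ ω (Ico r t) ∂(Z.P r z) := by
    intro t ht
    by_cases hrt : r ≤ t
    · exact @lintegral_compProd_indicator Ω (Z.F (Ici r)) (Z.P r z) _ κ _
        (fun ω => (f t (Z.X t ω) : ℝ≥0∞))
        (measurable_coe_nnreal_ennreal.comp ((hf t ht).comp (Z.measurable_X hrt))).aemeasurable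
        _ measurableSet_Ico
    · simp [Ico_eq_empty (fun h : r < t => hrt h.le)]
  refine ⟨(Finset.aemeasurable_fun_sum τ fun t ht => (k1 t ht).1).congr e1.symm,
    (Finset.aemeasurable_fun_sum τ fun t ht => (k2 t ht).1).congr e2.symm, ?_⟩
  rw [lintegral_congr_ae e1, lintegral_congr_ae e2,
    lintegral_finsetSum' _ fun t ht => (k1 t ht).1, lintegral_finsetSum' _ fun t ht => (k2 t ht).1]
  exact Finset.sum_congr rfl fun t ht => (k1 t ht).2.trans (k2 t ht).2.symm

/-- The approximating sequence of a functional in the class `𝒜₍₂₎` is asymptotically bounded by the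
functional on all future intervals simultaneously. -/
theorem ae_limsup_le {a : ℕ → AdditiveFunctional Z}
    (hlim : ∀ (r : ℝ≥0) (z : S), ∀ᵐ ω ∂(Z.P r z),
      Tendsto (fun n => (a n).meas ω (Ici r)) atTop (𝓝 (A.meas ω (Ici r))))
    {c : ℝ≥0} (hc : ∀ n ω s, (a n).meas ω (Ici s) ≤ c) (r : ℝ≥0) (z : S) :
    ∀ᵐ ω ∂(Z.P r z), ∀ s, r ≤ s →
      limsup (fun n => (a n).meas ω (Ici s)) atTop ≤ A.meas ω (Ici s) := by
  have h1 : ∀ d, r ≤ d → ∀ᵐ ω ∂(Z.P r z),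
      limsup (fun n => (a n).meas ω (Ici d)) atTop ≤ A.meas ω (Ici d) := by
    intro d hd
    have := Z.isProbabilityMeasure_dist hd z
    refine Z.ae_of_ae_law_dist hd ?_
    exact Z.ae_law_of_forall_start (HasVersion.limsup fun n => (a n).hasVersion_Ici_law d _)
      (A.hasVersion_Ici_law d _) (R := {p | p.1 ≤ p.2})
      (measurableSet_le measurable_fst measurable_snd)
      fun y => (hlim d y).mono fun ω hω => hω.limsup_eq.le
  have h2 : ∀ᵐ ω ∂(Z.P r z), ∀ n i : ℕ,
      limsup (fun k => (a k).meas ω (Ici (r ⊔ dyadicPoint n i))) atTop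
        ≤ A.meas ω (Ici (r ⊔ dyadicPoint n i)) :=
    ae_all_iff.2 fun n => ae_all_iff.2 fun i => h1 _ le_sup_left
  filter_upwards [h2, hlim r z] with ω hω hω' s hrs
  have hfin : A.meas ω (Ici r) < ∞ :=
    (le_of_tendsto' hω' fun n => hc n ω r).trans_lt ENNReal.coe_lt_top
  let d : ℕ → ℝ≥0 := fun n => r ⊔ dyadicPoint n (dyadicIndex n s)
  have hds : ∀ n, d n ≤ s := fun n => sup_le hrs (dyadicPoint_index_le n s)
  have hinter : ⋂ n, Ici (d n) = Ici s := by
    refine Subset.antisymm (fun x hx => ?_) (subset_iInter fun n => Ici_subset_Ici.2 (hds n))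
    simp only [d, mem_iInter, mem_Ici, sup_le_iff] at hx
    exact le_of_tendsto' (tendsto_dyadicFloor s) fun n => (hx n).2
  have hanti : Antitone fun n => Ici (d n) := fun i j hij =>
    Ici_subset_Ici.2 (sup_le_sup_left (monotone_dyadicFloor s hij) _)
  have htend : Tendsto (fun n => A.meas ω (Ici (d n))) atTop (𝓝 (A.meas ω (Ici s))) := by
    rw [← hinter]
    exact tendsto_measure_iInter_atTop (fun n => measurableSet_Ici.nullMeasurableSet) hanti
      ⟨0, ((measure_mono (Ici_subset_Ici.2 le_sup_left)).trans_lt hfin).ne⟩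
  refine ge_of_tendsto' htend fun n => ?_
  refine le_trans (limsup_le_limsup (Eventually.of_forall fun k => ?_)) (hω n (dyadicIndex n s))
  exact measure_mono (Ici_subset_Ici.2 (hds n))

theorem MemClass2.projection_le (hA : A.MemClass2) (hκ : IsAdaptedClock Z r z κ)
    (hatom : ∀ᵐ ω ∂(Z.P r z), ∀ s, κ ω {s} = 0) :
    AEMeasurable (fun p : Ω × ℝ≥0 => ∫⁻ ω', A.meas ω' (Ici p.2) ∂(Z.P p.2 (Z.X p.2 p.1)))
      (Z.P r z ⊗ₘ κ) ∧
    ∫⁻ p, ∫⁻ ω', A.meas ω' (Ici p.2) ∂(Z.P p.2 (Z.X p.2 p.1)) ∂(Z.P r z ⊗ₘ κ)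
      ≤ ∫⁻ p, A.meas p.1 (Ici p.2) ∂(Z.P r z ⊗ₘ κ) := by
  have := hκ.isFiniteKernel
  obtain ⟨a, ha, hlim, T, -, hT, c, hc⟩ := hA
  have hac : ∀ n ω s, (a n).meas ω (Ici s) ≤ c := by
    intro n ω s
    calc (a n).meas ω (Ici s) ≤ (a n).meas ω (Icc 0 T ∪ Ici T) :=
          measure_mono fun x _ => by
            rcases le_total x T with h | h
            · exact Or.inl ⟨zero_le, h⟩
            · exact Or.inr h
      _ ≤ (a n).meas ω (Icc 0 T) + (a n).meas ω (Ici T) := measure_union_le _ _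
      _ ≤ c := by rw [hT, add_zero]; exact hc n ω
  have k := fun n => (ha n).projection hκ hatom
  have hElim : ∀ p : Ω × ℝ≥0, Tendsto
      (fun n => ∫⁻ ω', (a n).meas ω' (Ici p.2) ∂(Z.P p.2 (Z.X p.2 p.1))) atTop
      (𝓝 (∫⁻ ω', A.meas ω' (Ici p.2) ∂(Z.P p.2 (Z.X p.2 p.1)))) := by
    intro p
    refine @tendsto_lintegral_of_dominated_convergence' _ (Z.F (Ici p.2)) _ _ _ (fun _ => (c : ℝ≥0∞))
      (fun n => (a n).aemeasurable_Ici _ _) (fun n => Eventually.of_forall fun ω => hac n ω _)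
      (by simp) (hlim _ _)
  have hbd : ∫⁻ _ : Ω × ℝ≥0, (c : ℝ≥0∞) ∂(Z.P r z ⊗ₘ κ) ≠ ∞ := by
    rw [lintegral_const]
    exact ENNReal.mul_ne_top ENNReal.coe_ne_top (measure_ne_top _ _)
  refine ⟨@aemeasurable_of_tendsto_metrizable_ae' _ _
    (@Prod.instMeasurableSpace Ω ℝ≥0 (Z.F (Ici r)) _) _ _ _ _ (Z.P r z ⊗ₘ κ) _ _ (fun n => (k n).1)
    (Eventually.of_forall hElim), ?_⟩
  have t1 := @tendsto_lintegral_of_dominated_convergence' _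
    (@Prod.instMeasurableSpace Ω ℝ≥0 (Z.F (Ici r)) _) (Z.P r z ⊗ₘ κ) _ _
    (fun _ => (c : ℝ≥0∞)) (fun n => (k n).1)
    (fun n => Eventually.of_forall fun p => ?_) hbd (Eventually.of_forall hElim)
  · rw [← t1.limsup_eq]
    have hmk := fun n => lintegral_congr_ae (k n).2.1.ae_eq_mk
    simp_rw [(k _).2.2, hmk]
    refine (@limsup_lintegral_le _ (@Prod.instMeasurableSpace Ω ℝ≥0 (Z.F (Ici r)) _)
      (Z.P r z ⊗ₘ κ) _ (fun _ => (c : ℝ≥0∞)) (fun n => (k n).2.1.measurable_mk)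
      (fun n => ?_) hbd).trans (lintegral_mono_ae ?_)
    · filter_upwards [(k n).2.1.ae_eq_mk] with p hp
      rw [← hp]
      exact hac n _ _
    · filter_upwards [ae_all_iff.2 fun n => (k n).2.1.ae_eq_mk,
        @ae_compProd_le Ω (Z.F (Ici r)) (Z.P r z) _ κ _ r hκ.before,
        @ae_compProd_of_ae_fst Ω (Z.F (Ici r)) (Z.P r z) _ κ _ _ (ae_limsup_le hlim hac r z)]
        with p h1 h2 h3
      simp_rw [← h1]
      exact h3 _ h2
  · calc ∫⁻ ω', (a n).meas ω' (Ici p.2) ∂(Z.P p.2 (Z.X p.2 p.1))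
        ≤ ∫⁻ _, (c : ℝ≥0∞) ∂(Z.P p.2 (Z.X p.2 p.1)) := lintegral_mono fun ω => hac n ω _
      _ = c := by simp

/-- For a functional in the class `𝒜` the potential `E_{s,X_s}[A[s,∞)]` is at most `A[s,∞)` on
average along an adapted clock without atoms.  Membership in `𝒜` enters because the atoms of `A`
contribute to the potential. -/
theorem MemClass.projection_le (hA : A.MemClass) (hκ : IsAdaptedClock Z r z κ)
    (hatom : ∀ᵐ ω ∂(Z.P r z), ∀ s, κ ω {s} = 0) :
    ∫⁻ p, ∫⁻ ω', A.meas ω' (Ici p.2) ∂(Z.P p.2 (Z.X p.2 p.1)) ∂(Z.P r z ⊗ₘ κ)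
      ≤ ∫⁻ p, A.meas p.1 (Ici p.2) ∂(Z.P r z ⊗ₘ κ) := by
  obtain ⟨a, ha, hlim⟩ := hA
  have hsup : ∀ ω s, A.meas ω (Ici s) = ⨆ n, (a n).meas ω (Ici s) := fun ω s =>
    tendsto_nhds_unique (hlim ω _ measurableSet_Ici).2
      (tendsto_atTop_iSup (hlim ω _ measurableSet_Ici).1)
  have hE : ∀ p : Ω × ℝ≥0, ∫⁻ ω', A.meas ω' (Ici p.2) ∂(Z.P p.2 (Z.X p.2 p.1))
      = ⨆ n, ∫⁻ ω', (a n).meas ω' (Ici p.2) ∂(Z.P p.2 (Z.X p.2 p.1)) := by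
    intro p
    simp_rw [hsup]
    exact lintegral_iSup' (fun n => (a n).aemeasurable_Ici _ _)
      (Eventually.of_forall fun ω => (hlim ω _ measurableSet_Ici).1)
  simp_rw [hE]
  rw [lintegral_iSup' fun n => ((ha n).projection_le hκ hatom).1]
  · refine iSup_le fun n => ((ha n).projection_le hκ hatom).2.trans (lintegral_mono fun p => ?_)
    rw [hsup]
    exact le_iSup (fun n => (a n).meas p.1 (Ici p.2)) n
  · exact Eventually.of_forall fun p i j hij =>
      lintegral_mono fun ω => (hlim ω _ measurableSet_Ici).1 hij

end AdditiveFunctional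

end Classes

/-! ### The killing rate of the linearized equation -/

/-- Convexity: the power function lies above its tangent at `y`. -/
theorem young_tangent {q : ℝ} (hq : 1 ≤ q) (x y : ℝ≥0) :
    q.toNNReal * y ^ (q - 1) * x ≤ x ^ q + (q - 1).toNNReal * y ^ q := by
  have hq0 : 0 < q := by linarith
  have h := NNReal.geom_mean_le_arith_mean2_weighted (1 / q).toNNReal ((q - 1) / q).toNNReal
    (x ^ q) (y ^ q) (by
      rw [← Real.toNNReal_add (by positivity) (div_nonneg (by linarith) hq0.le), ← add_div]
      simp [hq0.ne'])
  rw [Real.coe_toNNReal _ (by positivity), Real.coe_toNNReal _ (div_nonneg (by linarith) hq0.le),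
    ← NNReal.rpow_mul, ← NNReal.rpow_mul, mul_one_div_cancel hq0.ne', NNReal.rpow_one,
    mul_div_cancel₀ _ hq0.ne'] at h
  have hq1 : q.toNNReal * (1 / q).toNNReal = 1 := by
    rw [← Real.toNNReal_mul hq0.le, mul_one_div_cancel hq0.ne', Real.toNNReal_one]
  have hq2 : q.toNNReal * ((q - 1) / q).toNNReal = (q - 1).toNNReal := by
    rw [← Real.toNNReal_mul hq0.le, mul_div_cancel₀ _ hq0.ne']
  calc q.toNNReal * y ^ (q - 1) * x = q.toNNReal * (x * y ^ (q - 1)) := by ring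
    _ ≤ q.toNNReal * ((1 / q).toNNReal * x ^ q + ((q - 1) / q).toNNReal * y ^ q) := by gcongr
    _ = (q.toNNReal * (1 / q).toNNReal) * x ^ q
        + (q.toNNReal * ((q - 1) / q).toNNReal) * y ^ q := by ring
    _ = _ := by rw [hq1, hq2, one_mul]

theorem rpow_sub_one_le {q : ℝ} (hq : 1 ≤ q) (x : ℝ≥0) : x ^ (q - 1) ≤ 1 + x ^ q := by
  rcases le_total x 1 with h | h
  · exact (NNReal.rpow_le_one h (by linarith)).trans le_self_add
  · exact (NNReal.rpow_le_rpow_of_exponent_le h (by linarith)).trans le_add_self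

theorem measurable_nnreal_rpow (q : ℝ) : Measurable fun x : ℝ≥0 => x ^ q := by fun_prop

/-- Without any measurability, the integral over a product is at most the iterated one, because it is
attained by a measurable minorant. -/
theorem lintegral_compProd_le {Ω : Type*} [MeasurableSpace Ω] {P : Measure Ω} [IsFiniteMeasure P]
    {κ : Kernel Ω ℝ≥0} [IsFiniteKernel κ] (f : Ω × ℝ≥0 → ℝ≥0∞) :
    ∫⁻ p, f p ∂(P ⊗ₘ κ) ≤ ∫⁻ ω, ∫⁻ s, f (ω, s) ∂(κ ω) ∂P := by
  obtain ⟨g, hg, hgf, h⟩ := exists_measurable_le_lintegral_eq (P ⊗ₘ κ) f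
  rw [h, Measure.lintegral_compProd hg]
  exact lintegral_mono fun ω => lintegral_mono fun s => hgf _

section Rate

variable {S Ω : Type*} [TopologicalSpace S] [MeasurableSpace S] {Z : RightProcess S Ω}
  {r T : ℝ≥0} {z : S} {q : ℝ} {v : ℝ≥0 → S → ℝ≥0} {A L : AdditiveFunctional Z}

theorem IsProgressive.ae_aemeasurable (hv : IsProgressive Z T v) (hr : r ≤ T) :
    ∀ᵐ ω ∂(Z.P r z), ∀ ν : Measure ℝ≥0,
      AEMeasurable (fun u => v u (Z.X u ω)) (ν.restrict (Icc r T)) := by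
  obtain ⟨g, hg, hvg⟩ := hv r T hr le_rfl (Measure.dirac z) inferInstance
  rw [Z.law_dirac] at hvg
  filter_upwards [hvg] with ω hω ν
  refine ⟨fun u => g (u, ω), hg.comp (@measurable_prodMk_right _ _ _ (Z.F (Icc r T)) ω), ?_⟩
  exact (ae_restrict_iff' measurableSet_Icc).2 (Eventually.of_forall fun u hu => hω u hu)

theorem IsProgressive.hasVersion_start (hv : IsProgressive Z T v) (hL : L.IsContinuous)
    {h : ℝ≥0 → ℝ≥0∞} (hh : Measurable h) {t : ℝ≥0} (hrt : r ≤ t) (htT : t ≤ T) :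
    HasVersion (Z.F (Icc r t)) (Z.P r z)
      fun ω => ∫⁻ u in Icc r t, h (v u (Z.X u ω)) ∂(L.meas ω) := by
  have := hv.hasVersion_lintegral hL hh hrt htT (Measure.dirac z)
  rwa [Z.law_dirac] at this

theorem IsProgressive.aemeasurable_compProd (hv : IsProgressive Z T v) (hr : r ≤ T)
    {κ : @Kernel Ω ℝ≥0 (Z.F (Ici r)) _} (hκ : IsAdaptedClock Z r z κ)
    (hT : ∀ᵐ p ∂(Z.P r z ⊗ₘ κ), p.2 ≤ T) :
    AEMeasurable (fun p : Ω × ℝ≥0 => (v p.2 (Z.X p.2 p.1) : ℝ≥0∞)) (Z.P r z ⊗ₘ κ) := by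
  have := hκ.isFiniteKernel
  obtain ⟨g, hg, hvg⟩ := hv r T hr le_rfl (Measure.dirac z) inferInstance
  rw [Z.law_dirac] at hvg
  have hswap : Measurable[@Prod.instMeasurableSpace Ω ℝ≥0 (Z.F (Ici r)) _,
      @Prod.instMeasurableSpace ℝ≥0 Ω _ (Z.F (Icc r T))] (Prod.swap : Ω × ℝ≥0 → ℝ≥0 × Ω) :=
    (@measurable_swap Ω ℝ≥0 (Z.F (Icc r T)) _).mono
      (sup_le_sup_right (MeasurableSpace.comap_mono (Z.F_Icc_le le_rfl T)) _) le_rfl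
  refine ⟨fun p => (g p.swap : ℝ≥0∞), measurable_coe_nnreal_ennreal.comp (hg.comp hswap), ?_⟩
  filter_upwards [@ae_compProd_of_ae_fst Ω (Z.F (Ici r)) (Z.P r z) _ κ _ _ hvg,
    @ae_compProd_le Ω (Z.F (Ici r)) (Z.P r z) _ κ _ r hκ.before, hT] with p h1 h2 h3
  rw [h1 p.2 ⟨h2, h3⟩]
  rfl

/-- The random measure `q v(t,Z_t)^(q-1) L(dt)` on `[r,T]`, the rate in the linearization of the
equation at `v`. -/
noncomputable def killingRate (Z : RightProcess S Ω) (L : AdditiveFunctional Z) (T : ℝ≥0) (q : ℝ)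
    (v : ℝ≥0 → S → ℝ≥0) (r : ℝ≥0) (ω : Ω) : Measure ℝ≥0 :=
  ((L.meas ω).restrict (Icc r T)).withDensity
    fun u => ((q.toNNReal * v u (Z.X u ω) ^ (q - 1) : ℝ≥0) : ℝ≥0∞)

/-- The random measure `v(t,Z_t)^q L(dt)`.  The density is measurable in `t` only for almost every
`ω`; the masses of measurable sets are the expected integrals regardless. -/
noncomputable def powMeasure (Z : RightProcess S Ω) (L : AdditiveFunctional Z) (q : ℝ)
    (v : ℝ≥0 → S → ℝ≥0) (ω : Ω) : Measure ℝ≥0 :=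
  (L.meas ω).withDensity fun u => ((v u (Z.X u ω) ^ q : ℝ≥0) : ℝ≥0∞)

theorem powMeasure_Icc (s : ℝ≥0) (ω : Ω) :
    powMeasure Z L q v ω (Icc s T) = powIntegral Z L T q v s ω :=
  withDensity_apply _ measurableSet_Icc

theorem IsProgressive.hasVersion_powMeasure (hv : IsProgressive Z T v) (hL : L.IsContinuous)
    (q : ℝ) {t : ℝ≥0} (ht : t ≤ T) (μ : Measure S) [IsProbabilityMeasure μ] :
    HasVersion (Z.F (Ici t)) (Z.law t μ) fun ω => powMeasure Z L q v ω (Icc t T) := by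
  simp only [powMeasure_Icc]
  exact (hv.hasVersion_lintegral hL (measurable_coe_nnreal_ennreal.comp
    (measurable_nnreal_rpow q)) ht le_rfl μ).mono (Z.F_Icc_le le_rfl T)

theorem IsProgressive.aemeasurable_powIntegral (hv : IsProgressive Z T v) (hL : L.IsContinuous)
    (q : ℝ) (hr : r ≤ T) : AEMeasurable (powIntegral Z L T q v r) (Z.P r z) :=
  (hv.hasVersion_start hL (measurable_coe_nnreal_ennreal.comp
    (measurable_nnreal_rpow q)) hr le_rfl).aemeasurable (Z.F_Icc_le le_rfl T)

theorem AdditiveFunctional.IsContinuous.ae_restrict (hL : L.IsContinuous) (hr : r ≤ T) :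
    ∀ᵐ ω ∂(Z.P r z), L.meas ω (Icc r T) < ∞ ∧
      NullSingletonClass ((L.meas ω).restrict (Icc r T)) := by
  filter_upwards [hL r z] with ω hω
  refine ⟨(hω T hr).1, ⟨fun t => ?_⟩⟩
  rw [Measure.restrict_apply (measurableSet_singleton t)]
  by_cases ht : r ≤ t
  · exact measure_mono_null inter_subset_left (hω t ht).2
  · have : {t} ∩ Icc r T = ∅ := by
      ext x
      simp only [mem_inter_iff, mem_singleton_iff, mem_Icc, mem_empty_iff_false, iff_false]
      rintro ⟨rfl, h, _⟩
      exact ht h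
    rw [this, measure_empty]

theorem ae_killingRate (hq : 1 ≤ q) (hL : L.IsContinuous) (hv : IsProgressive Z T v) (hr : r ≤ T)
    (hint : ∫⁻ ω, powIntegral Z L T q v r ω ∂(Z.P r z) < ∞) :
    ∀ᵐ ω ∂(Z.P r z), IsFiniteMeasure (killingRate Z L T q v r ω) ∧
      NullSingletonClass (killingRate Z L T q v r ω) := by
  filter_upwards [hL.ae_restrict hr,
    ae_lt_top' (hv.aemeasurable_powIntegral hL q hr) hint.ne] with ω hω hfin
  have := hω.2
  refine ⟨⟨?_⟩, by unfold killingRate; infer_instance⟩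
  unfold killingRate
  rw [withDensity_apply _ MeasurableSet.univ, setLIntegral_univ]
  calc ∫⁻ u in Icc r T, ((q.toNNReal * v u (Z.X u ω) ^ (q - 1) : ℝ≥0) : ℝ≥0∞) ∂(L.meas ω)
      ≤ ∫⁻ u in Icc r T, (q.toNNReal : ℝ≥0∞) * (1 + ((v u (Z.X u ω) ^ q : ℝ≥0) : ℝ≥0∞))
          ∂(L.meas ω) := by
        refine lintegral_mono fun u => ?_
        have := mul_le_mul_right (rpow_sub_one_le hq (v u (Z.X u ω))) q.toNNReal
        exact (ENNReal.coe_le_coe.2 this).trans_eq (by push_cast; rfl)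
    _ = q.toNNReal * (L.meas ω (Icc r T) + powIntegral Z L T q v r ω) := by
        rw [lintegral_const_mul' _ _ ENNReal.coe_ne_top, lintegral_add_left measurable_const,
          setLIntegral_one]
        rfl
    _ < ∞ := ENNReal.mul_lt_top ENNReal.coe_lt_top (ENNReal.add_lt_top.2 ⟨hω.1, hfin⟩)

theorem killingRate_Iic {t : ℝ≥0} (ω : Ω) :
    killingRate Z L T q v r ω (Iic t) = ∫⁻ u in Icc r (t ⊓ T),
      ((q.toNNReal * v u (Z.X u ω) ^ (q - 1) : ℝ≥0) : ℝ≥0∞) ∂(L.meas ω) := by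
  unfold killingRate
  rw [withDensity_apply _ measurableSet_Iic, Measure.restrict_restrict measurableSet_Iic]
  congr 2
  ext x
  simp only [mem_inter_iff, mem_Iic, mem_Icc, le_inf_iff]
  tauto

theorem hasVersion_killingTime (hq : 1 ≤ q) (hL : L.IsContinuous) (hv : IsProgressive Z T v)
    (hr : r ≤ T) (hint : ∫⁻ ω, powIntegral Z L T q v r ω ∂(Z.P r z) < ∞) {t : ℝ≥0} (ht : r ≤ t) :
    HasVersion (Z.F (Icc r t)) (Z.P r z)
      fun ω => killingTime (killingRate Z L T q v r ω) (Iic t) := by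
  have hk : Measurable fun x : ℝ≥0 => ((q.toNNReal * x ^ (q - 1) : ℝ≥0) : ℝ≥0∞) :=
    measurable_coe_nnreal_ennreal.comp ((measurable_nnreal_rpow _).const_mul _)
  have h1 := (hv.hasVersion_start hL (z := z) hk (le_inf ht hr) inf_le_right).mono
    (Z.F_mono _ _ (Icc_subset_Icc_right inf_le_left : Icc r (t ⊓ T) ⊆ Icc r t))
  have hφ : Measurable fun x : ℝ≥0∞ => 1 - ENNReal.ofReal (Real.exp (-x.toReal)) := by fun_prop
  refine (h1.comp hφ).congr ?_
  filter_upwards [ae_killingRate hq hL hv hr hint] with ω hω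
  have := hω.1
  have := hω.2
  rw [killingTime_Iic, survival, measureReal_def, killingRate_Iic]

theorem killingTime_killingRate_compl (ω : Ω) :
    killingTime (killingRate Z L T q v r ω) (Icc r T)ᶜ = 0 := by
  unfold killingTime killingRate
  refine withDensity_absolutelyContinuous _ _ (withDensity_absolutelyContinuous _ _ ?_)
  rw [Measure.restrict_apply measurableSet_Icc.compl, compl_inter_self, measure_empty]

/-- The killing times of the killing rate form an adapted clock, after a modification on a null set. -/
theorem exists_clock (hq : 1 ≤ q) (hL : L.IsContinuous) (hv : IsProgressive Z T v)
    (hr : r ≤ T) (hint : ∫⁻ ω, powIntegral Z L T q v r ω ∂(Z.P r z) < ∞) :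
    ∃ κ : @Kernel Ω ℝ≥0 (Z.F (Ici r)) _, IsAdaptedClock Z r z κ ∧
      ∀ᵐ ω ∂(Z.P r z), κ ω = killingTime (killingRate Z L T q v r ω) := by
  have hreg := ae_killingRate hq hL hv hr hint
  have hbefore : ∀ ω, killingTime (killingRate Z L T q v r ω) (Iio r) = 0 := fun ω =>
    measure_mono_null (fun s hs => fun h => absurd hs (not_lt.2 h.1))
      (killingTime_killingRate_compl ω)
  obtain ⟨κ, hκ1, hκ2⟩ := @exists_kernel_ae_eq Ω (Z.F (Ici r)) (Z.P r z)
    (fun ω => killingTime (killingRate Z L T q v r ω)) (by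
      filter_upwards [hreg] with ω hω
      have := hω.1
      have := hω.2
      exact killingTime_univ_le _) (by
      intro t
      by_cases ht : r ≤ t
      · exact (hasVersion_killingTime hq hL hv hr hint ht).aemeasurable (Z.F_Icc_le le_rfl t)
      · have : ∀ ω, killingTime (killingRate Z L T q v r ω) (Iic t) = 0 := fun ω =>
          measure_mono_null (fun s hs => lt_of_le_of_lt hs (not_le.1 ht)) (hbefore ω)
        simp [this])
  refine ⟨κ, ⟨hκ1, ?_, fun t ht => ?_⟩, hκ2⟩
  · filter_upwards [hκ2] with ω hω
    rw [hω, hbefore]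
  · refine (hasVersion_killingTime hq hL hv hr hint ht).congr ?_
    filter_upwards [hκ2, hreg] with ω hω h
    have := h.1
    have := h.2
    rw [hω]
    exact measure_congr Iio_ae_eq_Iic

/-- The equation for a solution, written without subtraction. -/
theorem IsSolution.add_lintegral_eq (hL : L.IsContinuous) (hv : IsSolution Z A L T q v)
    (hA : A.MemClassT T 1) (hr : r ≤ T) (z : S) :
    (v r z : ℝ≥0∞) + ∫⁻ ω, powIntegral Z L T q v r ω ∂(Z.P r z)
      = ∫⁻ ω, A.meas ω (Icc r T) ∂(Z.P r z) := by
  have hAm := A.aemeasurable le_rfl T z (r := r)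
  have hAf : ∫⁻ ω, A.meas ω (Icc r T) ∂(Z.P r z) ≠ ∞ := by
    simpa using (hA.2 r hr z).1.ne
  have hCm := hv.progressive.aemeasurable_powIntegral hL q hr (z := z)
  have hCf := (hv.integrable r hr z).ne
  have h := hv.equation r hr z
  rw [integral_sub (integrable_toReal_of_lintegral_ne_top hAm hAf)
    (integrable_toReal_of_lintegral_ne_top hCm hCf),
    integral_toReal hAm (ae_lt_top' hAm hAf), integral_toReal hCm (ae_lt_top' hCm hCf)] at h
  rw [← ENNReal.toReal_eq_toReal_iff' (ENNReal.add_ne_top.2 ⟨ENNReal.coe_ne_top, hCf⟩) hAf,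
    ENNReal.toReal_add ENNReal.coe_ne_top hCf, ENNReal.coe_toReal, h]
  ring

end Rate

/-! ### Comparison of solutions -/

theorem measure_Icc_eq_killing {K M : Measure ℝ≥0} [IsFiniteMeasure K] [NullSingletonClass K]
    {r T : ℝ≥0} (hK : killingTime K (Icc r T)ᶜ = 0) (hM : M (Icc r T) < ∞) :
    M (Icc r T) = ∫⁻ s, M (Ioc s T) ∂(killingTime K) + ∫⁻ t in Icc r T, survival K t ∂M := by
  have : IsFiniteMeasure (M.restrict (Icc r T)) := ⟨by simpa using hM⟩
  have h := measure_univ_eq_killing K (M.restrict (Icc r T))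
  rw [Measure.restrict_apply_univ] at h
  rw [h]
  congr 1
  refine lintegral_congr_ae ?_
  filter_upwards [measure_eq_zero_iff_ae_notMem.1 hK] with s hs
  rw [notMem_compl_iff] at hs
  rw [Measure.restrict_apply measurableSet_Ioi]
  congr 1
  ext x
  simp only [mem_inter_iff, mem_Ioi, mem_Icc, mem_Ioc]
  exact ⟨fun h => ⟨h.1, h.2.2⟩, fun h => ⟨h.1, hs.1.trans h.1.le, h.2⟩⟩

theorem lintegral_measure_Ici_killingTime {K M : Measure ℝ≥0} [NullSingletonClass K]
    {r T : ℝ≥0} (hK : killingTime K (Icc r T)ᶜ = 0) (hM : M (Icc r T) < ∞) (hT : M (Ioi T) = 0) :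
    ∫⁻ s, M (Ici s) ∂(killingTime K) = ∫⁻ s, M (Ioc s T) ∂(killingTime K) := by
  have : IsFiniteMeasure (M.restrict (Icc r T)) := ⟨by simpa using hM⟩
  have h := lintegral_measure_Ici_eq (killingTime K) (M.restrict (Icc r T))
  have hs : ∀ᵐ s ∂(killingTime K), s ∈ Icc r T := by
    filter_upwards [measure_eq_zero_iff_ae_notMem.1 hK] with s hs using not_not.1 hs
  calc ∫⁻ s, M (Ici s) ∂(killingTime K)
      = ∫⁻ s, M.restrict (Icc r T) (Ici s) ∂(killingTime K) := by
        refine lintegral_congr_ae ?_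
        filter_upwards [hs] with s hs
        rw [Measure.restrict_apply measurableSet_Ici]
        refine le_antisymm ?_ (measure_mono inter_subset_left)
        calc M (Ici s) ≤ M (Ici s ∩ Icc r T ∪ Ioi T) := measure_mono fun x hx => by
              rcases le_or_gt x T with h' | h'
              · exact Or.inl ⟨hx, hs.1.trans hx, h'⟩
              · exact Or.inr h'
          _ ≤ M (Ici s ∩ Icc r T) + M (Ioi T) := measure_union_le _ _
          _ = M (Ici s ∩ Icc r T) := by rw [hT, add_zero]
    _ = ∫⁻ s, M.restrict (Icc r T) (Ioi s) ∂(killingTime K) := h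
    _ = ∫⁻ s, M (Ioc s T) ∂(killingTime K) := by
        refine lintegral_congr_ae ?_
        filter_upwards [hs] with s hs
        rw [Measure.restrict_apply measurableSet_Ioi]
        congr 1
        ext x
        simp only [mem_inter_iff, mem_Ioi, mem_Icc, mem_Ioc]
        exact ⟨fun h => ⟨h.1, h.2.2⟩, fun h => ⟨h.1, hs.1.trans h.1.le, h.2⟩⟩

theorem lintegral_killingTime_withDensity {l : Measure ℝ≥0} {d f : ℝ≥0 → ℝ≥0∞}
    (hd : AEMeasurable d l) (hf : AEMeasurable f l) [IsFiniteMeasure (l.withDensity d)] :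
    ∫⁻ s, f s ∂(killingTime (l.withDensity d))
      = ∫⁻ s, survival (l.withDensity d) s * (d s * f s) ∂l := by
  have hφ := measurable_survival (l.withDensity d)
  unfold killingTime
  rw [lintegral_withDensity_eq_lintegral_mul₀ hφ.aemeasurable
      (hf.mono_ac (withDensity_absolutelyContinuous _ _)),
    lintegral_withDensity_eq_lintegral_mul₀ hd
      (hφ.aemeasurable.mul hf)]
  refine lintegral_congr fun s => ?_
  simp only [Pi.mul_apply]
  ring

section Comparison

variable {S Ω : Type*} [TopologicalSpace S] [MeasurableSpace S] {Z : RightProcess S Ω}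
  {r T : ℝ≥0} {z : S} {q : ℝ} {v : ℝ≥0 → S → ℝ≥0} {A L : AdditiveFunctional Z}

/-- Integration by parts along a killing clock, in expectation. -/
theorem lintegral_Icc_eq_killing {κ : @Kernel Ω ℝ≥0 (Z.F (Ici r)) _}
    (hκ : IsAdaptedClock Z r z κ) {K M : Ω → Measure ℝ≥0}
    (hκK : ∀ᵐ ω ∂(Z.P r z), κ ω = killingTime (K ω))
    (hK : ∀ᵐ ω ∂(Z.P r z), IsFiniteMeasure (K ω) ∧ NullSingletonClass (K ω))
    (hKT : ∀ ω, killingTime (K ω) (Icc r T)ᶜ = 0)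
    (hMm : AEMeasurable (fun ω => M ω (Icc r T)) (Z.P r z))
    (hMf : ∫⁻ ω, M ω (Icc r T) ∂(Z.P r z) ≠ ∞)
    (hMt : AEMeasurable (fun p : Ω × ℝ≥0 => M p.1 (Ioc p.2 T)) (Z.P r z ⊗ₘ κ)) :
    AEMeasurable (fun ω => ∫⁻ t in Icc r T, survival (K ω) t ∂(M ω)) (Z.P r z) ∧
    ∫⁻ ω, M ω (Icc r T) ∂(Z.P r z) = ∫⁻ p, M p.1 (Ioc p.2 T) ∂(Z.P r z ⊗ₘ κ)
      + ∫⁻ ω, ∫⁻ t in Icc r T, survival (K ω) t ∂(M ω) ∂(Z.P r z) := by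
  have := hκ.isFiniteKernel
  obtain ⟨h1, h2⟩ := @lintegral_compProd_of_aemeasurable Ω (Z.F (Ici r)) (Z.P r z) _ κ _ _ hMt
  have hsplit : ∀ᵐ ω ∂(Z.P r z), M ω (Icc r T) < ∞ ∧ M ω (Icc r T)
      = ∫⁻ s, M ω (Ioc s T) ∂(κ ω) + ∫⁻ t in Icc r T, survival (K ω) t ∂(M ω) := by
    filter_upwards [hκK, hK, ae_lt_top' hMm hMf] with ω e1 e2 e3
    have := e2.1
    have := e2.2
    rw [e1]
    exact ⟨e3, measure_Icc_eq_killing (hKT ω) e3⟩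
  refine ⟨(hMm.sub h1).congr ?_, ?_⟩
  · filter_upwards [hsplit] with ω hω
    have hne : ∫⁻ s, M ω (Ioc s T) ∂(κ ω) ≠ ∞ :=
      ((le_self_add.trans hω.2.ge).trans_lt hω.1).ne
    simp only [Pi.sub_apply]
    rw [hω.2, ENNReal.add_sub_cancel_left hne]
  · rw [lintegral_congr_ae (hsplit.mono fun ω hω => hω.2), lintegral_add_left' h1, h2]

/-- The equation for a solution in terms of the left-open tail of the absorption term, which makes no
difference because that term has no atoms. -/
theorem IsSolution.add_lintegral_Ioc_eq (hL : L.IsContinuous) (hv : IsSolution Z A L T q v)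
    (hA : A.MemClassT T 1) (hr : r ≤ T) (z : S) :
    (v r z : ℝ≥0∞) + ∫⁻ ω, powMeasure Z L q v ω (Ioc r T) ∂(Z.P r z)
      = ∫⁻ ω, A.meas ω (Icc r T) ∂(Z.P r z) := by
  rw [← hv.add_lintegral_eq hL hA hr z]
  congr 1
  refine lintegral_congr_ae ?_
  filter_upwards [hL r z] with ω hω
  rw [← powMeasure_Icc, ← Ioc_insert_left hr, insert_eq]
  have h0 : powMeasure Z L q v ω {r} = 0 :=
    withDensity_absolutelyContinuous _ _ (hω r le_rfl).2
  exact le_antisymm (measure_mono subset_union_right)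
    ((measure_union_le _ _).trans (by rw [h0, zero_add]))

theorem IsProgressive.projection_powMeasure (hv : IsProgressive Z T v) (hL : L.IsContinuous)
    {κ : @Kernel Ω ℝ≥0 (Z.F (Ici r)) _} (hκ : IsAdaptedClock Z r z κ) (q : ℝ) :
    AEMeasurable (fun p : Ω × ℝ≥0 => ∫⁻ ω', powMeasure Z L q v ω' (Ioc p.2 T) ∂(Z.P p.2 (Z.X p.2 p.1)))
      (Z.P r z ⊗ₘ κ) ∧
    AEMeasurable (fun p : Ω × ℝ≥0 => powMeasure Z L q v p.1 (Ioc p.2 T)) (Z.P r z ⊗ₘ κ) ∧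
    ∫⁻ p, ∫⁻ ω', powMeasure Z L q v ω' (Ioc p.2 T) ∂(Z.P p.2 (Z.X p.2 p.1)) ∂(Z.P r z ⊗ₘ κ)
      = ∫⁻ p, powMeasure Z L q v p.1 (Ioc p.2 T) ∂(Z.P r z ⊗ₘ κ) :=
  hκ.projection_tail (M := powMeasure Z L q v) (T := T)
    fun _ ht μ _ => hv.hasVersion_powMeasure hL q ht μ

theorem AdditiveFunctional.projection_tail (A : AdditiveFunctional Z)
    {κ : @Kernel Ω ℝ≥0 (Z.F (Ici r)) _} (hκ : IsAdaptedClock Z r z κ) (T : ℝ≥0) :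
    AEMeasurable (fun p : Ω × ℝ≥0 => ∫⁻ ω', A.meas ω' (Ioc p.2 T) ∂(Z.P p.2 (Z.X p.2 p.1)))
      (Z.P r z ⊗ₘ κ) ∧
    AEMeasurable (fun p : Ω × ℝ≥0 => A.meas p.1 (Ioc p.2 T)) (Z.P r z ⊗ₘ κ) ∧
    ∫⁻ p, ∫⁻ ω', A.meas ω' (Ioc p.2 T) ∂(Z.P p.2 (Z.X p.2 p.1)) ∂(Z.P r z ⊗ₘ κ)
      = ∫⁻ p, A.meas p.1 (Ioc p.2 T) ∂(Z.P r z ⊗ₘ κ) :=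
  hκ.projection_tail (M := A.meas) (T := T)
    fun t _ μ _ => (A.hasVersion_law t T μ).mono (Z.F_Icc_le le_rfl T)

/-- A solution is bounded above by the Feynman–Kac functional for the killing rate `K`. -/
theorem IsSolution.add_le_killing (hL : L.IsContinuous) (hv : IsSolution Z A L T q v)
    (hA : A.MemClassT T 1) (hr : r ≤ T) {κ : @Kernel Ω ℝ≥0 (Z.F (Ici r)) _}
    (hκ : IsAdaptedClock Z r z κ) {K : Ω → Measure ℝ≥0}
    (hκK : ∀ᵐ ω ∂(Z.P r z), κ ω = killingTime (K ω))
    (hK : ∀ᵐ ω ∂(Z.P r z), IsFiniteMeasure (K ω) ∧ NullSingletonClass (K ω))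
    (hKT : ∀ ω, killingTime (K ω) (Icc r T)ᶜ = 0) :
    (v r z : ℝ≥0∞)
        + ∫⁻ ω, ∫⁻ t in Icc r T, survival (K ω) t ∂(powMeasure Z L q v ω) ∂(Z.P r z)
      ≤ ∫⁻ p, (v p.2 (Z.X p.2 p.1) : ℝ≥0∞) ∂(Z.P r z ⊗ₘ κ)
        + ∫⁻ ω, ∫⁻ t in Icc r T, survival (K ω) t ∂(A.meas ω) ∂(Z.P r z) := by
  obtain ⟨c1, c2, c3⟩ := hv.progressive.projection_powMeasure hL hκ q
  obtain ⟨a1, a2, a3⟩ := A.projection_tail hκ T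
  have hCf : ∫⁻ ω, powMeasure Z L q v ω (Icc r T) ∂(Z.P r z) ≠ ∞ := by
    simp only [powMeasure_Icc]
    exact (hv.integrable r hr z).ne
  have hAf : ∫⁻ ω, A.meas ω (Icc r T) ∂(Z.P r z) ≠ ∞ := by
    simpa using (hA.2 r hr z).1.ne
  have hCm : AEMeasurable (fun ω => powMeasure Z L q v ω (Icc r T)) (Z.P r z) := by
    simp only [powMeasure_Icc]
    exact hv.progressive.aemeasurable_powIntegral hL q hr
  have hC := (lintegral_Icc_eq_killing hκ hκK hK hKT hCm hCf c2).2
  have hA' := (lintegral_Icc_eq_killing hκ hκK hK hKT (A.aemeasurable le_rfl T z) hAf a2).2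
  have hle : ∫⁻ p, A.meas p.1 (Ioc p.2 T) ∂(Z.P r z ⊗ₘ κ)
      ≤ ∫⁻ p, (v p.2 (Z.X p.2 p.1) : ℝ≥0∞) ∂(Z.P r z ⊗ₘ κ)
        + ∫⁻ p, powMeasure Z L q v p.1 (Ioc p.2 T) ∂(Z.P r z ⊗ₘ κ) := by
    rw [← a3, ← c3, ← lintegral_add_right' _ c1]
    refine lintegral_mono fun p => ?_
    by_cases hp : p.2 ≤ T
    · rw [hv.add_lintegral_Ioc_eq hL hA hp]
      exact lintegral_mono fun ω => measure_mono Ioc_subset_Icc_self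
    · simp [Ioc_eq_empty fun h : p.2 < T => hp h.le]
  have heq := hv.add_lintegral_eq hL hA hr z
  simp only [powMeasure_Icc] at hC hCf
  have hcf : ∫⁻ p, powMeasure Z L q v p.1 (Ioc p.2 T) ∂(Z.P r z ⊗ₘ κ) ≠ ∞ :=
    ne_top_of_le_ne_top hCf (le_self_add.trans hC.ge)
  rw [hC, hA'] at heq
  refine (ENNReal.add_le_add_iff_left hcf).1 ?_
  calc _ = (v r z : ℝ≥0∞) + (∫⁻ p, powMeasure Z L q v p.1 (Ioc p.2 T) ∂(Z.P r z ⊗ₘ κ)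
        + ∫⁻ ω, ∫⁻ t in Icc r T, survival (K ω) t ∂(powMeasure Z L q v ω) ∂(Z.P r z)) := by
        rw [add_left_comm]
    _ ≤ _ := by
        rw [heq]
        refine (add_le_add_left hle _).trans_eq ?_
        ring

/-- A solution is bounded below by the Feynman–Kac functional for the killing rate `K`. -/
theorem IsSolution.killing_le_add (hL : L.IsContinuous) (hv : IsSolution Z A L T q v)
    (hA : A.MemClassT T 1) (hr : r ≤ T) {κ : @Kernel Ω ℝ≥0 (Z.F (Ici r)) _}
    (hκ : IsAdaptedClock Z r z κ) {K : Ω → Measure ℝ≥0}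
    (hκK : ∀ᵐ ω ∂(Z.P r z), κ ω = killingTime (K ω))
    (hK : ∀ᵐ ω ∂(Z.P r z), IsFiniteMeasure (K ω) ∧ NullSingletonClass (K ω))
    (hKT : ∀ ω, killingTime (K ω) (Icc r T)ᶜ = 0) :
    ∫⁻ ω, ∫⁻ s, (v s (Z.X s ω) : ℝ≥0∞) ∂(κ ω) ∂(Z.P r z)
        + ∫⁻ ω, ∫⁻ t in Icc r T, survival (K ω) t ∂(A.meas ω) ∂(Z.P r z)
      ≤ (v r z : ℝ≥0∞)
        + ∫⁻ ω, ∫⁻ t in Icc r T, survival (K ω) t ∂(powMeasure Z L q v ω) ∂(Z.P r z) := by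
  have := hκ.isFiniteKernel
  obtain ⟨c1, c2, c3⟩ := hv.progressive.projection_powMeasure hL hκ q
  obtain ⟨a1, a2, a3⟩ := A.projection_tail hκ T
  have hCf : ∫⁻ ω, powMeasure Z L q v ω (Icc r T) ∂(Z.P r z) ≠ ∞ := by
    simp only [powMeasure_Icc]
    exact (hv.integrable r hr z).ne
  have hAf : ∫⁻ ω, A.meas ω (Icc r T) ∂(Z.P r z) ≠ ∞ := by
    simpa using (hA.2 r hr z).1.ne
  have hCm : AEMeasurable (fun ω => powMeasure Z L q v ω (Icc r T)) (Z.P r z) := by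
    simp only [powMeasure_Icc]
    exact hv.progressive.aemeasurable_powIntegral hL q hr
  have hAm := A.aemeasurable le_rfl T z (r := r)
  have hC := (lintegral_Icc_eq_killing hκ hκK hK hKT hCm hCf c2).2
  have hA' := (lintegral_Icc_eq_killing hκ hκK hK hKT hAm hAf a2).2
  have hpT : ∀ᵐ p ∂(Z.P r z ⊗ₘ κ), p.2 ≤ T := by
    refine (@Measure.ae_compProd_iff _ _ (Z.F (Ici r)) _ _ _ _ _
      (fun p : Ω × ℝ≥0 => p.2 ≤ T)
      (@measurableSet_le _ _ _ _ _ (@Prod.instMeasurableSpace Ω ℝ≥0 (Z.F (Ici r)) _) _ _ _ _ _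
        measurable_snd measurable_const)).2 ?_
    filter_upwards [hκK] with ω hω
    rw [hω]
    filter_upwards [measure_eq_zero_iff_ae_notMem.1 (hKT ω)] with s hs
    exact (not_not.1 hs).2
  have hvm := hv.progressive.aemeasurable_compProd hr hκ hpT
  have hatom : ∀ᵐ ω ∂(Z.P r z), ∀ s, κ ω {s} = 0 := by
    filter_upwards [hκK, hK] with ω e1 e2 s
    have := e2.2
    rw [e1]
    exact measure_singleton s
  have hle : ∫⁻ p, (v p.2 (Z.X p.2 p.1) : ℝ≥0∞) ∂(Z.P r z ⊗ₘ κ)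
        + ∫⁻ p, powMeasure Z L q v p.1 (Ioc p.2 T) ∂(Z.P r z ⊗ₘ κ)
      ≤ ∫⁻ p, A.meas p.1 (Ioc p.2 T) ∂(Z.P r z ⊗ₘ κ) := by
    rw [← c3, ← lintegral_add_right' _ c1]
    calc _ ≤ ∫⁻ p, ∫⁻ ω', A.meas ω' (Ici p.2) ∂(Z.P p.2 (Z.X p.2 p.1)) ∂(Z.P r z ⊗ₘ κ) := by
          refine lintegral_mono_ae ?_
          filter_upwards [hpT] with p hp
          rw [hv.add_lintegral_Ioc_eq hL hA hp]
          exact lintegral_mono fun ω => measure_mono Icc_subset_Ici_self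
      _ ≤ ∫⁻ p, A.meas p.1 (Ici p.2) ∂(Z.P r z ⊗ₘ κ) := hA.1.projection_le hκ hatom
      _ ≤ ∫⁻ ω, ∫⁻ s, A.meas ω (Ici s) ∂(κ ω) ∂(Z.P r z) :=
          @lintegral_compProd_le Ω (Z.F (Ici r)) (Z.P r z) _ κ _ _
      _ = ∫⁻ ω, ∫⁻ s, A.meas ω (Ioc s T) ∂(κ ω) ∂(Z.P r z) := by
          refine lintegral_congr_ae ?_
          filter_upwards [hκK, hK, ae_lt_top' hAm hAf, (hA.2 r hr z).2] with ω e1 e2 e3 e4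
          have := e2.2
          rw [e1]
          exact lintegral_measure_Ici_killingTime (hKT ω) e3 e4
      _ = _ := (@lintegral_compProd_of_aemeasurable Ω (Z.F (Ici r)) (Z.P r z) _ κ _ _ a2).2.symm
  rw [(@lintegral_compProd_of_aemeasurable Ω (Z.F (Ici r)) (Z.P r z) _ κ _ _ hvm).2] at hle
  have heq := hv.add_lintegral_eq hL hA hr z
  simp only [powMeasure_Icc] at hC hCf
  have hcf : ∫⁻ p, powMeasure Z L q v p.1 (Ioc p.2 T) ∂(Z.P r z ⊗ₘ κ) ≠ ∞ :=
    ne_top_of_le_ne_top hCf (le_self_add.trans hC.ge)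
  rw [hC, hA'] at heq
  refine (ENNReal.add_le_add_iff_left hcf).1 ?_
  rw [add_left_comm _ (v r z : ℝ≥0∞), heq]
  refine le_trans (le_of_eq ?_) (add_le_add_left hle _)
  ring

end Comparison

/-- Probabilistic parabolic maximum principle.  The state space `S` is a metrizable Luzin space:
a separable metrizable space whose Borel σ-algebra is standard. -/
theorem proposition3p1 {S Ω : Type*} [TopologicalSpace S] [TopologicalSpace.MetrizableSpace S]
    [SecondCountableTopology S] [MeasurableSpace S] [BorelSpace S] [StandardBorelSpace S]
    (Z : RightProcess S Ω) (T : ℝ≥0) (hT : 0 < T)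
    (A A' L L' : AdditiveFunctional Z)
    (hA : A.MemClassT T 1) (hA' : A'.MemClassT T 1)
    (hL : L.IsContinuous) (hL' : L'.IsContinuous)
    (hAA' : ∀ r t : ℝ≥0, r ≤ t → t ≤ T → ∀ z : S,
      ∀ᵐ ω ∂(Z.P r z), A.meas ω (Icc r t) ≤ A'.meas ω (Icc r t))
    (hLL' : ∀ r t : ℝ≥0, r ≤ t → t ≤ T → ∀ z : S,
      ∀ᵐ ω ∂(Z.P r z), L'.meas ω (Icc r t) ≤ L.meas ω (Icc r t))
    (q : ℝ) (hq : 1 ≤ q) (v v' : ℝ≥0 → S → ℝ≥0)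
    (hv : IsSolution Z A L T q v) (hv' : IsSolution Z A' L' T q v') :
    ∀ r : ℝ≥0, r ≤ T → ∀ z : S, v r z ≤ v' r z := by
  intro r hr z
  have hint' := hv'.integrable r hr z
  obtain ⟨κ, hκ, hκK⟩ := exists_clock hq hL' hv'.progressive hr hint'
  have hκfin := hκ.isFiniteKernel
  have hK := ae_killingRate hq hL' hv'.progressive hr hint'
  set K := killingRate Z L' T q v' r with hKdef
  have hKT : ∀ ω, killingTime (K ω) (Icc r T)ᶜ = 0 := killingTime_killingRate_compl
  have hup := hv.add_le_killing hL hA hr hκ hκK hK hKT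
  have hlow := hv'.killing_le_add hL' hA' hr hκ hκK hK hKT
  set l : Ω → Measure ℝ≥0 := fun ω => (L'.meas ω).restrict (Icc r T) with hl
  have hAle : ∫⁻ ω, ∫⁻ t in Icc r T, survival (K ω) t ∂(A.meas ω) ∂(Z.P r z)
      ≤ ∫⁻ ω, ∫⁻ t in Icc r T, survival (K ω) t ∂(A'.meas ω) ∂(Z.P r z) := by
    have hA'f : ∫⁻ ω, A'.meas ω (Icc r T) ∂(Z.P r z) ≠ ∞ := by
      simpa using (hA'.2 r hr z).1.ne
    refine lintegral_mono_ae ?_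
    filter_upwards [AdditiveFunctional.ae_restrict_le z hAA'
      (ae_lt_top' (A'.aemeasurable le_rfl T z) hA'f)] with ω hω
    exact lintegral_mono' hω le_rfl
  -- The weighted absorption terms, and the path integrals of `v` and `v'` along the clock, are
  -- integrals with respect to the additive functionals.
  have hpow : ∀ {L₀ : AdditiveFunctional Z} {w : ℝ≥0 → S → ℝ≥0}, IsProgressive Z T w →
      ∀ᵐ ω ∂(Z.P r z), ∫⁻ t in Icc r T, survival (K ω) t ∂(powMeasure Z L₀ q w ω)
        = ∫⁻ t in Icc r T, survival (K ω) t * ((w t (Z.X t ω) ^ q : ℝ≥0) : ℝ≥0∞)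
          ∂(L₀.meas ω) := by
    intro L₀ w hw
    filter_upwards [hw.ae_aemeasurable hr, hK] with ω e1 e2
    have := e2.1
    have hm : AEMeasurable (fun t => ((w t (Z.X t ω) ^ q : ℝ≥0) : ℝ≥0∞))
        ((L₀.meas ω).restrict (Icc r T)) :=
      ((e1 _).pow_const q).coe_nnreal_ennreal
    rw [powMeasure, restrict_withDensity measurableSet_Icc,
      lintegral_withDensity_eq_lintegral_mul₀ hm (measurable_survival _).aemeasurable]
    simp only [Pi.mul_apply, mul_comm]
  have hclock : ∀ {w : ℝ≥0 → S → ℝ≥0}, IsProgressive Z T w → ∀ᵐ ω ∂(Z.P r z),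
      ∫⁻ s, (w s (Z.X s ω) : ℝ≥0∞) ∂(κ ω) = ∫⁻ t, survival (K ω) t
        * ((q.toNNReal * v' t (Z.X t ω) ^ (q - 1) * w t (Z.X t ω) : ℝ≥0) : ℝ≥0∞) ∂(l ω) := by
    intro w hw
    filter_upwards [hw.ae_aemeasurable hr, hv'.progressive.ae_aemeasurable hr, hK, hκK]
      with ω e1 e2 e3 e4
    have : IsFiniteMeasure ((l ω).withDensity
      fun u => ((q.toNNReal * v' u (Z.X u ω) ^ (q - 1) : ℝ≥0) : ℝ≥0∞)) := e3.1
    rw [e4, hKdef]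
    unfold killingRate
    rw [lintegral_killingTime_withDensity
      ((((e2 _).pow_const (q - 1)).const_mul _).coe_nnreal_ennreal) (e1 _).coe_nnreal_ennreal]
    simp only [ENNReal.coe_mul]
    rfl
  set X := ∫⁻ ω, ∫⁻ t, survival (K ω) t * ((v t (Z.X t ω) ^ q : ℝ≥0) : ℝ≥0∞) ∂(l ω) ∂(Z.P r z)
    with hX
  set Y := ∫⁻ ω, ∫⁻ t, survival (K ω) t * ((v' t (Z.X t ω) ^ q : ℝ≥0) : ℝ≥0∞) ∂(l ω) ∂(Z.P r z)
    with hY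
  have hYeq : ∫⁻ ω, ∫⁻ t in Icc r T, survival (K ω) t ∂(powMeasure Z L' q v' ω) ∂(Z.P r z) = Y :=
    lintegral_congr_ae (hpow hv'.progressive)
  have hLle : ∀ᵐ ω ∂(Z.P r z), l ω ≤ (L.meas ω).restrict (Icc r T) :=
    AdditiveFunctional.ae_restrict_le z hLL' ((hL r z).mono fun ω hω => (hω T hr).1)
  have hXle : X ≤ ∫⁻ ω, ∫⁻ t in Icc r T, survival (K ω) t ∂(powMeasure Z L q v ω)
      ∂(Z.P r z) := by
    refine lintegral_mono_ae ?_
    filter_upwards [hpow (L₀ := L) hv.progressive, hLle] with ω e1 e2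
    rw [e1]
    exact lintegral_mono' e2 le_rfl
  have hsurv : ∀ {L₀ : AdditiveFunctional Z} {w : ℝ≥0 → S → ℝ≥0} (ω : Ω),
      ∫⁻ t in Icc r T, survival (K ω) t * ((w t (Z.X t ω) ^ q : ℝ≥0) : ℝ≥0∞) ∂(L₀.meas ω)
        ≤ powIntegral Z L₀ T q w r ω := fun ω =>
    lintegral_mono fun t => mul_le_of_le_one_left zero_le (survival_le_one _ _)
  have hXf : X ≠ ∞ := by
    refine ne_top_of_le_ne_top (hv.integrable r hr z).ne (lintegral_mono_ae ?_)
    filter_upwards [hLle] with ω e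
    exact (lintegral_mono' e le_rfl).trans (hsurv (L₀ := L) ω)
  have hYf : Y ≠ ∞ :=
    ne_top_of_le_ne_top hint'.ne (lintegral_mono fun ω => hsurv (L₀ := L') ω)
  -- The weighted absorption term of `v'` depends measurably on the path.
  have hYm : AEMeasurable (fun ω => ∫⁻ t, survival (K ω) t
      * ((v' t (Z.X t ω) ^ q : ℝ≥0) : ℝ≥0∞) ∂(l ω)) (Z.P r z) := by
    refine (lintegral_Icc_eq_killing (M := powMeasure Z L' q v') hκ hκK hK hKT ?_ ?_
      (hv'.progressive.projection_powMeasure hL' hκ q).2.1).1.congr (hpow hv'.progressive)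
    · simp only [powMeasure_Icc]
      exact hv'.progressive.aemeasurable_powIntegral hL' q hr
    · simp only [powMeasure_Icc]
      exact hint'.ne
  have hvX : ∫⁻ p, (v p.2 (Z.X p.2 p.1) : ℝ≥0∞) ∂(Z.P r z ⊗ₘ κ)
      ≤ X + ((q - 1).toNNReal : ℝ≥0∞) * Y := by
    refine (@lintegral_compProd_le Ω (Z.F (Ici r)) (Z.P r z) _ κ _ _).trans ?_
    rw [lintegral_congr_ae (hclock hv.progressive), hX, hY,
      ← lintegral_const_mul' _ _ ENNReal.coe_ne_top,
      ← lintegral_add_right' _ (hYm.const_mul _)]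
    refine lintegral_mono_ae ?_
    filter_upwards [hv'.progressive.ae_aemeasurable hr, hK] with ω e1 e2
    have := e2.1
    have hm : AEMeasurable (fun t => survival (K ω) t
        * ((v' t (Z.X t ω) ^ q : ℝ≥0) : ℝ≥0∞)) (l ω) :=
      (measurable_survival _).aemeasurable.mul ((e1 _).pow_const q).coe_nnreal_ennreal
    rw [← lintegral_const_mul' _ _ ENNReal.coe_ne_top,
      ← lintegral_add_right' _ (hm.const_mul _)]
    refine lintegral_mono fun t => ?_
    calc _ ≤ survival (K ω) t * ((v t (Z.X t ω) ^ q
          + (q - 1).toNNReal * v' t (Z.X t ω) ^ q : ℝ≥0) : ℝ≥0∞) := by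
          gcongr
          exact young_tangent hq _ _
      _ = _ := by push_cast; ring
  have hvY : ∫⁻ ω, ∫⁻ s, (v' s (Z.X s ω) : ℝ≥0∞) ∂(κ ω) ∂(Z.P r z)
      = Y + ((q - 1).toNNReal : ℝ≥0∞) * Y := by
    have hq1 : (1 : ℝ≥0∞) + (q - 1).toNNReal = q.toNNReal := by
      rw [← ENNReal.coe_one, ← ENNReal.coe_add, ← Real.toNNReal_one,
        ← Real.toNNReal_add zero_le_one (by linarith)]
      ring_nf
    rw [lintegral_congr_ae (hclock hv'.progressive), ← one_add_mul, hq1, hY,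
      ← lintegral_const_mul' _ _ ENNReal.coe_ne_top]
    refine lintegral_congr fun ω => ?_
    rw [← lintegral_const_mul' _ _ ENNReal.coe_ne_top]
    refine lintegral_congr fun t => ?_
    have : v' t (Z.X t ω) ^ (q - 1) * v' t (Z.X t ω) = v' t (Z.X t ω) ^ q := by
      rw [← NNReal.rpow_add_one' (by linarith), sub_add_cancel]
    rw [mul_assoc q.toNNReal, this]
    push_cast
    ring
  rw [hYeq, hvY] at hlow
  set J := ∫⁻ ω, ∫⁻ t in Icc r T, survival (K ω) t ∂(A'.meas ω) ∂(Z.P r z) with hJ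
  have h1 : (v r z : ℝ≥0∞) ≤ ((q - 1).toNNReal : ℝ≥0∞) * Y + J := by
    refine (ENNReal.add_le_add_iff_left hXf).1 ?_
    calc X + (v r z : ℝ≥0∞) ≤ _ := by rw [add_comm]; exact add_le_add_right hXle _
      _ ≤ _ := hup
      _ ≤ (X + ((q - 1).toNNReal : ℝ≥0∞) * Y) + J := add_le_add hvX hAle
      _ = _ := by rw [add_assoc]
  have h2 : ((q - 1).toNNReal : ℝ≥0∞) * Y + J ≤ v' r z := by
    refine (ENNReal.add_le_add_iff_left hYf).1 ?_
    rw [← add_assoc, add_comm Y (v' r z : ℝ≥0∞)]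
    exact hlow
  exact_mod_cast h1.trans h2
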